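/- **Proposition.** Fix integers $d,m,n,r\ge 0$ and real numbers $K$ and $\theta>0$. There are constants $\theta'>0$ and $C>0$, depending only on $(d,m,n,r,K,\theta)$, such that the following holds. Notation: $\langle x\rangle=(1+|x|^2)^{1/2}$ with the Euclidean norm; for $\zeta\in\{\pm\}$, $u^{+}=u$ and $u^{-}=\overline u$. Let $A$ be a finite set with $|A|=r$, let $\zeta_j\in\{\pm\}$ $(j\in A)$ be signs, and write $k_A=(k_j)_{j\in A}\in(\mathbb Z^d)^A$. Two entries $k_i,k_j$ form a pairing if $\zeta_i=-\zeta_j$ and $k_i=k_j$. For a partition $(B,C)$ of $A$ (that is, $C=A\setminus B$, both parts possibly empty) and $h=h_{bck_A}$ with $b\in(\mathbb Z^d)^m$, $c\in(\mathbb Z^d)^n$, put $$\|h\|_{bk_B\to ck_C}=\sup\Big\{\Big(\sum_{c,k_C}\Big|\sum_{b,k_B}h_{bck_A}z_{bk_B}\Big|^2\Big)^{1/2}:\ \sum_{b,k_B}|z_{bk_B}|^2=1\Big\},$$ and similarly $\|H\|_{b\to c}=\sup\big\{\big(\sum_c|\sum_b H_{bc}z_b|^2\big)^{1/2}:\sum_b|z_b|^2=1\big\}$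 for $H=H_{bc}$. Let $(\eta_k)_{k\in\mathbb Z^d}$ be independent random variables on a probability space, each uniformly distributed on the unit circle of $\mathbb C$. Let $M=2^s$ with $s\in\mathbb Z_{\ge 0}$ and let $0<\tau\le 1$. Let $h_{bck_A}=h_{bck_A}(\omega)$ be a complex random tensor such that, for every $\omega$, on the support of $h$ one has $\langle b\rangle\le KM$, $\langle c\rangle\le KM$, $\langle k_j\rangle\le KM$ for all $j\in A$, and there is no pairing in $k_A$. Let $E\subset\mathbb Z^d$ be a finite set such that the collection $\{h_{bck_A}\}$ is independent of the collection $\{\eta_k:k\in E\}$, and define $$H_{bc}=\sum_{k_A:\ k_j\in E\ \forall j\in A}h_{bck_A}\prod_{j\in A}\eta_{k_j}^{\zeta_j}.$$ Then, with probability at least $1-Ce^{-(\tau^{-1}M)^{\theta'}}$, $$\|H\|_{b\to c}\le C\,\tau^{-\theta}M^{\theta}\cdot\max_{(B,C)}\|h\|_{bk_B\to ck_C},$$ where $(B,C)$ runs over all partitions of $A$. -/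

import Mathlib

open MeasureTheory ProbabilityTheory
open scoped ENNReal

namespace RandomTensor

/-- The lattice `ℤ^d`. -/
abbrev Lattice (d : ℕ) : Type := Fin d → ℤ

/-- The Japanese bracket `⟨k⟩ = (1 + |k|²)^{1/2}` of a lattice vector `k ∈ ℤ^d`. -/
noncomputable def bracket {d : ℕ} (k : Lattice d) : ℝ :=
  Real.sqrt (1 + ∑ i, (k i : ℝ) ^ 2)

/-- The Japanese bracket `⟨b⟩ = (1 + |b|²)^{1/2}` of a vector `b ∈ (ℤ^d)^n`. -/
noncomputable def bracketPow {d n : ℕ} (b : Fin n → Lattice d) : ℝ :=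
  Real.sqrt (1 + ∑ l, ∑ i, (b l i : ℝ) ^ 2)

/-- `u^ζ` for a sign `ζ ∈ {±1}`: `u^+ = u` and `u^- = conj u`. -/
noncomputable def signPow (u : ℂ) (ζ : ℤˣ) : ℂ :=
  if ζ = 1 then u else (starRingEnd ℂ) u

/-- `(k_i, k_j)` is a pairing (with respect to the signs `ζ`): opposite signs, same vector. -/
def IsPairing {d : ℕ} {A : Type*} (ζ : A → ℤˣ) (k : A → Lattice d) (i j : A) : Prop :=
  (ζ i : ℤ) + (ζ j : ℤ) = 0 ∧ k i = k j

/-- The uniform probability distribution on the unit circle of `ℂ`: the law of `exp (2πit)` for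
`t` uniformly distributed in `[0, 1)`. -/
noncomputable def unitCircleLaw : Measure ℂ :=
  (volume.restrict (Set.Ico (0 : ℝ) 1)).map
    (fun t : ℝ => Complex.exp (2 * Real.pi * t * Complex.I))

/-- The `ℓ²(α) → ℓ²(β)` norm of the kernel `T = T_{ab}`, with values in `[0, ∞]`:
`‖T‖_{a → b} = sup { (∑_b |∑_a T_{ab} z_a|²)^{1/2} : ∑_a |z_a|² = 1 }`. -/
noncomputable def kernelNorm {α β : Type*} (T : α → β → ℂ) : ℝ≥0∞ :=
  ⨆ (z : α → ℂ) (_ : HasSum (fun a => ‖z a‖ ^ 2) 1),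
    (∑' b, ‖∑' a, T a b * z a‖ₑ ^ 2) ^ (1 / 2 : ℝ)

/-- The vector `k_A` with prescribed parts `k_B` and `k_C`, where `C = A \ B`. -/
def glue {d : ℕ} {A : Type*} [DecidableEq A] (B : Finset A)
    (kB : {j // j ∈ B} → Lattice d) (kC : {j // j ∉ B} → Lattice d) : A → Lattice d :=
  fun j => if hj : j ∈ B then kB ⟨j, hj⟩ else kC ⟨j, hj⟩

/-- The norm `‖h‖_{b k_B → c k_C}` of a tensor `h = h_{b c k_A}`, for the partition `(B, C)` of `A`
with `C = A \ B`. -/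
noncomputable def tensorNorm {d m n : ℕ} {A : Type*} [DecidableEq A]
    (h : (Fin m → Lattice d) → (Fin n → Lattice d) → (A → Lattice d) → ℂ) (B : Finset A) : ℝ≥0∞ :=
  kernelNorm (fun (x : (Fin m → Lattice d) × ({j // j ∈ B} → Lattice d))
    (y : (Fin n → Lattice d) × ({j // j ∉ B} → Lattice d)) => h x.1 y.1 (glue B x.2 y.2))

/-- The contraction `H_{bc} = ∑_{k_A} h_{b c k_A} ∏_{j ∈ A} u_{k_j}^{ζ_j}`, the sum being
restricted to `k_j ∈ E` for all `j ∈ A`. -/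
noncomputable def contraction {d m n : ℕ} {A : Type*} [Fintype A] [DecidableEq A] (ζ : A → ℤˣ)
    (E : Finset (Lattice d)) (u : Lattice d → ℂ)
    (h : (Fin m → Lattice d) → (Fin n → Lattice d) → (A → Lattice d) → ℂ)
    (b : Fin m → Lattice d) (c : Fin n → Lattice d) : ℂ :=
  ∑ k ∈ Fintype.piFinset (fun _ : A => E), h b c k * ∏ j, signPow (u (k j)) (ζ j)

end RandomTensor

namespace RandomTensor

open scoped Matrix.Norms.L2Operator Matrix

/-! ### The `ℓ²` operator norm of a matrix -/

section OpNorm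

variable {I J I' J' : Type*} [Fintype I] [DecidableEq I] [Fintype J] [DecidableEq J]
  [Fintype I'] [DecidableEq I'] [Fintype J'] [DecidableEq J']

/-! On the support of `h` all vectors lie in a finite box, so H is a matrix polynomial Σ_k T_k ∏_j
η_{k_j}^{ζ_j} (`signPoly`), where T_k is the c × b matrix of `h`. The norm ‖h‖_{bk_B→ck_C} dominates
that of the matrix in which the slots of B become column indices and those of C row indices
(`flatten`). The proof bounds high moments of ‖H‖ divided by the largest of these norms.

If each slot carried its own family of independent random signs, the slots could be removed one at a
time. With the other signs fixed, H is a Rademacher sum Σ ε_k A_k, and the noncommutative Khintchine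
inequality controls it by the norms of the A_k placed side by side and on top of each other: the
slot has become a column or a row index. After r steps only flattenings are left
(`sum_opNorm_chaos_pow_le`).

Two devices lead to that situation. Decoupling: sort the k by their pattern of coincidences and
colour the lattice points by classes of slots. H is a weighted sum of the coloured pieces
(`signPoly_eq_sum_restrictPattern`), with total weight bounded in terms of r only
(`sum_patternWeight_le`); within a piece, different classes use disjoint sets of variables. Signs:
the law of η is invariant under rotations, and rotating η_l by an n-th root of a product of n signs
multiplies η_l^n by that product. Without pairings a class of n slots contributes η_l^n or its
conjugate, so every slot acquires its own sign (`signPoly_patternRotation_mul`). The remaining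
factors of η and the colour and coincidence cutoffs do not increase any flattening norm.

Since `h` and η are independent, their joint law is invariant under the rotations and no
conditioning on `h` is needed. Markov's inequality then gives the tail, with a moment of order a
small power of L = M/τ: the growth of the Khintchine constants is absorbed by L^θ and the
dimensions, polynomial in L, by an exponential (`exists_moment_bound`). -/

theorem sum_norm_sq_mulVec_le (M : Matrix I J ℂ) (v : J → ℂ) :
    ∑ i, ‖(M *ᵥ v) i‖ ^ 2 ≤ ‖M‖ ^ 2 * ∑ j, ‖v j‖ ^ 2 := by
  have h := M.l2_opNorm_mulVec (WithLp.toLp 2 v)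
  have h2 := pow_le_pow_left₀ (norm_nonneg _) h 2
  rw [mul_pow, EuclideanSpace.norm_sq_eq, EuclideanSpace.norm_sq_eq] at h2
  simpa using h2

theorem opNorm_le_of_sum_norm_sq_le {M : Matrix I J ℂ} {c : ℝ} (hc : 0 ≤ c)
    (h : ∀ v : J → ℂ, ∑ i, ‖(M *ᵥ v) i‖ ^ 2 ≤ c ^ 2 * ∑ j, ‖v j‖ ^ 2) : ‖M‖ ≤ c := by
  rw [Matrix.l2_opNorm_def]
  refine ContinuousLinearMap.opNorm_le_bound _ hc fun x => ?_
  refine (sq_le_sq₀ (norm_nonneg _) (by positivity)).mp ?_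
  rw [mul_pow, EuclideanSpace.norm_sq_eq, EuclideanSpace.norm_sq_eq]
  exact h x

theorem norm_entry_le_opNorm (M : Matrix I J ℂ) (i : I) (j : J) : ‖M i j‖ ≤ ‖M‖ := by
  have h := sum_norm_sq_mulVec_le M (Pi.single j 1)
  have h1 : ∑ x, ‖(Pi.single j 1 : J → ℂ) x‖ ^ 2 = 1 := by
    rw [Finset.sum_eq_single j] <;> simp +contextual [Pi.single_apply]
  rw [h1, mul_one] at h
  have h2 := (Finset.single_le_sum (f := fun i => ‖(M *ᵥ (Pi.single j 1 : J → ℂ)) i‖ ^ 2)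
    (fun _ _ => by positivity) (Finset.mem_univ i)).trans h
  simp only [Matrix.mulVec_single_one, Matrix.col_apply] at h2
  exact (sq_le_sq₀ (norm_nonneg _) (norm_nonneg _)).mp h2

theorem opNorm_submatrix_le (M : Matrix I J ℂ) {f : I' → I} {g : J' → J}
    (hf : f.Injective) (hg : g.Injective) : ‖M.submatrix f g‖ ≤ ‖M‖ := by
  refine opNorm_le_of_sum_norm_sq_le (norm_nonneg _) fun v => ?_
  let w : J → ℂ := Function.extend g v 0
  have hw : ∀ F : J → ℂ → ℝ, (∀ j, F j 0 = 0) → ∑ j, F j (w j) = ∑ j', F (g j') (v j') := by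
    intro F hF
    rw [← Finset.sum_subset (Finset.subset_univ (Finset.univ.image g)),
      Finset.sum_image hg.injOn]
    · exact Finset.sum_congr rfl fun j' _ => by simp [w, hg.extend_apply]
    · intro j _ hj
      rw [show w j = 0 from Function.extend_apply' _ _ _ (by simpa using hj), hF]
  have hw' : ∀ i, (M *ᵥ w) i = ∑ j', M i (g j') * v j' := by
    intro i
    rw [Matrix.mulVec, dotProduct, ← Finset.sum_subset (Finset.subset_univ (Finset.univ.image g)),
      Finset.sum_image hg.injOn]
    · exact Finset.sum_congr rfl fun j' _ => by simp [w, hg.extend_apply]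
    · intro j _ hj
      rw [show w j = 0 from Function.extend_apply' _ _ _ (by simpa using hj), mul_zero]
  have h := sum_norm_sq_mulVec_le M w
  rw [hw (fun _ z => ‖z‖ ^ 2) (by simp)] at h
  refine le_trans ?_ h
  calc ∑ i, ‖(M.submatrix f g *ᵥ v) i‖ ^ 2 = ∑ i, ‖(M *ᵥ w) (f i)‖ ^ 2 := by
        refine Finset.sum_congr rfl fun i _ => ?_
        rw [hw']; rfl
    _ = ∑ i ∈ Finset.univ.image f, ‖(M *ᵥ w) i‖ ^ 2 := by rw [Finset.sum_image hf.injOn]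
    _ ≤ _ := Finset.sum_le_sum_of_subset_of_nonneg (Finset.subset_univ _)
        fun _ _ _ => by positivity

/-- This is M between two diagonal contractions. -/
theorem opNorm_scale_le (M : Matrix I J ℂ) {u : I → ℂ} {v : J → ℂ}
    (hu : ∀ i, ‖u i‖ ≤ 1) (hv : ∀ j, ‖v j‖ ≤ 1) :
    ‖Matrix.of fun i j => u i * M i j * v j‖ ≤ ‖M‖ := by
  refine opNorm_le_of_sum_norm_sq_le (norm_nonneg _) fun w => ?_
  have h := sum_norm_sq_mulVec_le M (fun j => v j * w j)
  calc _ ≤ ∑ i, ‖(M *ᵥ fun j => v j * w j) i‖ ^ 2 := by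
        refine Finset.sum_le_sum fun i _ => ?_
        have : (Matrix.of (fun i j => u i * M i j * v j) *ᵥ w) i
            = u i * (M *ᵥ fun j => v j * w j) i := by
          simp [Matrix.mulVec, dotProduct, Finset.mul_sum, mul_assoc]
        rw [this, norm_mul, mul_pow]
        exact mul_le_of_le_one_left (by positivity) (pow_le_one₀ (norm_nonneg _) (hu i))
    _ ≤ _ := h
    _ ≤ _ := by
        gcongr with j
        rw [norm_mul]
        exact mul_le_of_le_one_left (by positivity) (hv j)

/-- The level sets of φ and ψ cut M into blocks. Only diagonal blocks survive; they act on
orthogonal pieces of w and land in orthogonal pieces, so the squared norms add up. -/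
theorem opNorm_pinching_le {t : Type*} [DecidableEq t] (M : Matrix I J ℂ) (φ : I → t) (ψ : J → t) :
    ‖Matrix.of fun i j => if φ i = ψ j then M i j else 0‖ ≤ ‖M‖ := by
  refine opNorm_le_of_sum_norm_sq_le (norm_nonneg _) fun w => ?_
  let w' : t → J → ℂ := fun s j => if ψ j = s then w j else 0
  have h1 : ∀ i, (Matrix.of (fun i j => if φ i = ψ j then M i j else 0) *ᵥ w) i
      = (M *ᵥ w' (φ i)) i := by
    intro i
    simp only [Matrix.mulVec, dotProduct, Matrix.of_apply, w']
    refine Finset.sum_congr rfl fun j _ => ?_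
    by_cases h : φ i = ψ j <;> simp [h, eq_comm]
  calc _ = ∑ i, ‖(M *ᵥ w' (φ i)) i‖ ^ 2 := by simp_rw [h1]
    _ = ∑ s ∈ Finset.univ.image φ, ∑ i with φ i = s, ‖(M *ᵥ w' s) i‖ ^ 2 := by
        rw [← Finset.sum_fiberwise_of_maps_to (t := Finset.univ.image φ) (g := φ)
          (fun i _ => by simp)]
        refine Finset.sum_congr rfl fun s _ => Finset.sum_congr rfl fun i hi => ?_
        rw [(Finset.mem_filter.mp hi).2]
    _ ≤ ∑ s ∈ Finset.univ.image φ, ‖M‖ ^ 2 * ∑ j, ‖w' s j‖ ^ 2 := by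
        refine Finset.sum_le_sum fun s _ => le_trans ?_ (sum_norm_sq_mulVec_le M (w' s))
        exact Finset.sum_le_sum_of_subset_of_nonneg (Finset.subset_univ _)
          fun _ _ _ => by positivity
    _ = ‖M‖ ^ 2 * ∑ j, ∑ s ∈ Finset.univ.image φ, ‖w' s j‖ ^ 2 := by
        rw [← Finset.mul_sum, Finset.sum_comm]
    _ ≤ _ := by
        gcongr with j
        have : ∀ s, ‖w' s j‖ ^ 2 = if ψ j = s then ‖w j‖ ^ 2 else 0 := by
          intro s; by_cases h : ψ j = s <;> simp [w', h]
        simp_rw [this]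
        rw [Finset.sum_ite_eq]
        split_ifs
        · exact le_rfl
        · positivity

theorem measurable_opNorm {X : Type*} [MeasurableSpace X] {M : X → Matrix I J ℂ}
    (hM : ∀ i j, Measurable fun x => M x i j) : Measurable fun x => ‖M x‖ := by
  have hc : Continuous fun m : I → J → ℂ => ‖(Matrix.of m : Matrix I J ℂ)‖ :=
    (continuous_norm (E := Matrix I J ℂ))
  exact hc.measurable.comp (measurable_pi_lambda _ fun i => measurable_pi_lambda _ fun j => hM i j)

end OpNorm

/-! ### Traces of powers of Hermitian matrices -/

section Trace

variable {I : Type*} [Fintype I] [DecidableEq I]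

/-- A single pair (U, l) serves all powers at once, so that traces mixing different powers can be
compared. -/
theorem exists_unitary_diagonalization {X : Matrix I I ℂ} (hX : X.IsHermitian) :
    ∃ (U : Matrix I I ℂ) (l : I → ℝ), Uᴴ * U = 1 ∧ U * Uᴴ = 1 ∧
      ∀ q : ℕ, X ^ q = U * Matrix.diagonal (fun i => ((l i ^ q : ℝ) : ℂ)) * Uᴴ := by
  have hU := hX.eigenvectorUnitary.2
  rw [Matrix.mem_unitaryGroup_iff] at hU
  have hU' := hX.eigenvectorUnitary.2
  rw [Matrix.mem_unitaryGroup_iff'] at hU'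
  refine ⟨hX.eigenvectorUnitary.1, hX.eigenvalues, hU', hU, fun q => ?_⟩
  have h := hX.spectral_theorem
  rw [Unitary.conjStarAlgAut_apply] at h
  have hd : (fun i => ((hX.eigenvalues i ^ q : ℝ) : ℂ))
      = (RCLike.ofReal ∘ hX.eigenvalues : I → ℂ) ^ q := by
    ext i; simp
  rw [hd, ← Matrix.diagonal_pow]
  set U : Matrix I I ℂ := hX.eigenvectorUnitary.1
  set D : Matrix I I ℂ := Matrix.diagonal (RCLike.ofReal ∘ hX.eigenvalues)
  have h' : X = U * D * Uᴴ := h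
  rw [h']
  induction q with
  | zero => simpa [Matrix.star_eq_conjTranspose] using hU.symm
  | succ q ih =>
    rw [pow_succ, ih (by ext; simp), pow_succ]
    calc U * D ^ q * Uᴴ * (U * D * Uᴴ) = U * D ^ q * (Uᴴ * U) * D * Uᴴ := by
          simp only [Matrix.mul_assoc]
      _ = _ := by rw [show Uᴴ * U = 1 from hU', Matrix.mul_one]; simp only [Matrix.mul_assoc]

theorem re_trace_conjTranspose_mul_self {J : Type*} [Fintype J] (B : Matrix J I ℂ) :
    (Bᴴ * B).trace.re = ∑ i, ∑ j, ‖B j i‖ ^ 2 := by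
  simp only [Matrix.trace, Matrix.diag, Matrix.mul_apply, Matrix.conjTranspose_apply, Complex.re_sum]
  refine Finset.sum_congr rfl fun i _ => Finset.sum_congr rfl fun j _ => ?_
  rw [Complex.star_def, ← Complex.normSq_eq_conj_mul_self, Complex.ofReal_re, Complex.sq_norm]

theorem pow_mul_pow_le_add_of_add_eq (a b : ℝ) {p q s : ℕ} (h : q + s = 2 * p) :
    a ^ q * b ^ s ≤ a ^ (2 * p) + b ^ (2 * p) := by
  have h1 : a ^ q * b ^ s ≤ |a| ^ q * |b| ^ s := by
    rw [← abs_pow, ← abs_pow, ← abs_mul]; exact le_abs_self _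
  refine h1.trans ?_
  rw [pow_mul a, pow_mul b, ← sq_abs a, ← sq_abs b, ← pow_mul, ← pow_mul, ← h]
  rcases le_total |a| |b| with hab | hab
  · calc _ ≤ |b| ^ q * |b| ^ s := by gcongr
      _ = |b| ^ (q + s) := (pow_add ..).symm
      _ ≤ _ := le_add_of_nonneg_left (by positivity)
  · calc _ ≤ |a| ^ q * |a| ^ s := by gcongr
      _ = |a| ^ (q + s) := (pow_add ..).symm
      _ ≤ _ := le_add_of_nonneg_right (by positivity)

/-- Diagonalizing X and Y separately turns the trace into Σ |G_ij|² l_j^q m_i^s. The weights |G_ij|²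
are nonnegative and do not depend on the exponents, so the scalar inequality applies termwise, even
for odd q and s. -/
theorem re_trace_mul_pow_mul_pow_le {H X Y : Matrix I I ℂ} (hH : H.IsHermitian)
    (hX : X.IsHermitian) (hY : Y.IsHermitian) {p q s : ℕ} (h : q + s = 2 * p) :
    (H * X ^ q * H * Y ^ s).trace.re
      ≤ (H * X ^ (2 * p) * H).trace.re + (H * Y ^ (2 * p) * H).trace.re := by
  obtain ⟨U, l, -, -, hUX⟩ := exists_unitary_diagonalization hX
  obtain ⟨V, m, hV, hV', hVY⟩ := exists_unitary_diagonalization hY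
  set G : Matrix I I ℂ := Vᴴ * H * U
  have hG : Gᴴ = Uᴴ * H * V := by
    simp [G, Matrix.conjTranspose_mul, hH.eq, Matrix.mul_assoc]
  have key : ∀ q s : ℕ, (H * X ^ q * H * Y ^ s).trace.re
      = ∑ i, ∑ j, ‖G i j‖ ^ 2 * (l j ^ q * m i ^ s) := by
    intro q s
    have h1 : (H * X ^ q * H * Y ^ s).trace
        = (G * Matrix.diagonal (fun i => ((l i ^ q : ℝ) : ℂ)) * Gᴴ
          * Matrix.diagonal (fun i => ((m i ^ s : ℝ) : ℂ))).trace := by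
      rw [hUX, hVY, hG]
      simp only [G, Matrix.mul_assoc]
      rw [Matrix.trace_mul_comm Vᴴ]
      simp only [Matrix.mul_assoc]
    rw [h1, Matrix.trace, Complex.re_sum]
    refine Finset.sum_congr rfl fun i _ => ?_
    rw [Matrix.diag_apply, Matrix.mul_diagonal, Matrix.mul_apply, Finset.sum_mul, Complex.re_sum]
    refine Finset.sum_congr rfl fun j _ => ?_
    rw [Matrix.mul_diagonal, Matrix.conjTranspose_apply]
    have : G i j * ((l j ^ q : ℝ) : ℂ) * star (G i j) * ((m i ^ s : ℝ) : ℂ)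
        = ((‖G i j‖ ^ 2 * (l j ^ q * m i ^ s) : ℝ) : ℂ) := by
      rw [Complex.ofReal_mul, Complex.sq_norm, Complex.normSq_eq_conj_mul_self,
        Complex.ofReal_mul, Complex.star_def]
      ring
    rw [this, Complex.ofReal_re]
  have e1 := key (2 * p) 0
  have e2 := key 0 (2 * p)
  rw [pow_zero, Matrix.mul_one] at e1
  rw [pow_zero, Matrix.mul_one, Matrix.mul_assoc, Matrix.trace_mul_comm] at e2
  rw [key, e1, e2, ← Finset.sum_add_distrib]
  refine Finset.sum_le_sum fun i _ => ?_
  rw [← Finset.sum_add_distrib]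
  refine Finset.sum_le_sum fun j _ => ?_
  rw [← mul_add]
  refine mul_le_mul_of_nonneg_left ?_ (by positivity)
  simpa using pow_mul_pow_le_add_of_add_eq (l j) (m i) h

/-- The even power makes every eigenvalue contribute nonnegatively, so the trace dominates the
largest one. -/
theorem opNorm_pow_le_re_trace {X : Matrix I I ℂ} (hX : X.IsHermitian) {p : ℕ} (hp : p ≠ 0) :
    ‖X‖ ^ (2 * p) ≤ (X ^ (2 * p)).trace.re := by
  obtain ⟨U, l, hU, hU', hUX⟩ := exists_unitary_diagonalization hX
  have htr : (X ^ (2 * p)).trace.re = ∑ i, l i ^ (2 * p) := by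
    rw [hUX, Matrix.trace_mul_comm, ← Matrix.mul_assoc, hU, Matrix.one_mul, Matrix.trace,
      Complex.re_sum]
    exact Finset.sum_congr rfl fun i _ => by simp [← Complex.ofReal_pow]
  have hU1 : ‖U‖ ≤ 1 := by
    refine opNorm_le_of_sum_norm_sq_le zero_le_one fun v => le_of_eq ?_
    have h1 : ∀ w : I → ℂ, (∑ i, ‖w i‖ ^ 2 : ℝ) = (star w ⬝ᵥ w).re := by
      intro w
      rw [dotProduct, Complex.re_sum]
      refine Finset.sum_congr rfl fun j _ => ?_
      rw [Pi.star_apply, Complex.star_def, ← Complex.normSq_eq_conj_mul_self, Complex.ofReal_re,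
        Complex.sq_norm]
    rw [one_pow, one_mul, h1, h1, Matrix.star_mulVec, Matrix.dotProduct_mulVec,
      Matrix.vecMul_vecMul, hU, Matrix.vecMul_one]
  have hX1 : ‖X‖ ≤ ‖l‖ := by
    have h2 := hUX 1
    simp only [pow_one] at h2
    rw [h2]
    calc _ ≤ ‖U‖ * ‖(Matrix.diagonal (fun i => (l i : ℂ)) : Matrix I I ℂ)‖ * ‖Uᴴ‖ :=
          (Matrix.l2_opNorm_mul _ _).trans
            (mul_le_mul_of_nonneg_right (Matrix.l2_opNorm_mul _ _) (norm_nonneg _))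
      _ ≤ 1 * ‖l‖ * 1 := by
          rw [Matrix.l2_opNorm_conjTranspose, Matrix.l2_opNorm_diagonal]
          have : ‖fun i => (l i : ℂ)‖ ≤ ‖l‖ :=
            (pi_norm_le_iff_of_nonneg (norm_nonneg _)).mpr fun i => by
              rw [Complex.norm_real]; exact norm_le_pi_norm l i
          gcongr
      _ = _ := by ring
  rw [htr]
  rcases isEmpty_or_nonempty I with hI | hI
  · have : ‖X‖ = 0 := by rw [Subsingleton.elim X 0, norm_zero]
    rw [this, zero_pow (by omega)]; simp
  · obtain ⟨i, -, hi⟩ := Finset.exists_max_image Finset.univ (fun i => ‖l i‖) Finset.univ_nonempty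
    have h3 : ‖l‖ ≤ ‖l i‖ :=
      (pi_norm_le_iff_of_nonneg (norm_nonneg _)).mpr fun j => hi j (Finset.mem_univ j)
    calc ‖X‖ ^ (2 * p) ≤ ‖l i‖ ^ (2 * p) := pow_le_pow_left₀ (norm_nonneg _) (hX1.trans h3) _
      _ = l i ^ (2 * p) := by rw [Real.norm_eq_abs, pow_mul, sq_abs, ← pow_mul]
      _ ≤ _ := Finset.single_le_sum (f := fun i => l i ^ (2 * p))
          (fun j _ => by rw [pow_mul]; positivity) (Finset.mem_univ i)

theorem pow_sub_pow_eq_sum {R : Type*} [Ring R] (X Y : R) (m : ℕ) :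
    X ^ m - Y ^ m = ∑ q ∈ Finset.range m, X ^ q * (X - Y) * Y ^ (m - 1 - q) := by
  have h := Finset.sum_range_sub (fun q => X ^ q * Y ^ (m - q)) m
  simp only [Nat.sub_self, pow_zero, mul_one, Nat.sub_zero, one_mul] at h
  rw [← h]
  refine Finset.sum_congr rfl fun q hq => ?_
  have hq' := Finset.mem_range.mp hq
  rw [show m - q = (m - 1 - q) + 1 by omega, show m - (q + 1) = m - 1 - q by omega,
    pow_succ, pow_succ']
  noncomm_ring

end Trace

/-! ### The noncommutative Khintchine inequality for random signs -/

section Khintchine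

variable {I κ : Type*} [Fintype I] [DecidableEq I] [Fintype κ] [DecidableEq κ]

/-- The Rademacher sum `∑ ε_k H_k`. -/
noncomputable def signSum {V : Type*} [AddCommMonoid V] [Module ℂ V] (H : κ → V) (ε : κ → ℤˣ) : V :=
  ∑ k, ((ε k : ℤ) : ℂ) • H k

theorem signSum_isHermitian {H : κ → Matrix I I ℂ} (hH : ∀ k, (H k).IsHermitian) (ε : κ → ℤˣ) :
    (signSum H ε).IsHermitian := by
  unfold signSum Matrix.IsHermitian
  rw [Matrix.conjTranspose_sum]
  refine Finset.sum_congr rfl fun k _ => ?_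
  rw [Matrix.conjTranspose_smul, (hH k).eq]
  simp

/-- Flipping the sign at `k`. -/
def flipSign (k : κ) : Equiv.Perm (κ → ℤˣ) :=
  Function.Involutive.toPerm (fun ε => Function.update ε k (-ε k)) fun ε => by
    ext j; by_cases h : j = k
    · subst h; simp
    · simp [h]

theorem flipSign_self (k : κ) (ε : κ → ℤˣ) : flipSign k ε k = -ε k :=
  Function.update_self ..

theorem flipSign_of_ne {k j : κ} (h : j ≠ k) (ε : κ → ℤˣ) : flipSign k ε j = ε j :=
  Function.update_of_ne h ..

theorem signSum_sub_flipSign (H : κ → Matrix I I ℂ) (ε : κ → ℤˣ) (k : κ) :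
    signSum H ε - signSum H (flipSign k ε) = (2 * ((ε k : ℤ) : ℂ)) • H k := by
  unfold signSum
  rw [← Finset.sum_sub_distrib, Finset.sum_eq_single k]
  · simp [flipSign_self, two_mul, add_smul]
  · intro j _ hj; simp [flipSign_of_ne hj]
  · simp

/-- A discrete integration by parts. Averaging with the flip of ε_k replaces the power of the sum by
a difference of powers, which telescopes and releases a second factor H_k. The 2p + 1 mixed traces
are then replaced by pure ones. -/
theorem sum_sign_mul_re_trace_le {H : κ → Matrix I I ℂ} (hH : ∀ k, (H k).IsHermitian)
    (p : ℕ) (k : κ) :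
    ∑ ε : κ → ℤˣ, ((ε k : ℤ) : ℝ) * (H k * signSum H ε ^ (2 * p + 1)).trace.re
      ≤ 2 * (2 * p + 1) * ∑ ε : κ → ℤˣ, (H k * signSum H ε ^ (2 * p) * H k).trace.re := by
  set t : (κ → ℤˣ) → ℝ := fun ε => (H k * signSum H ε ^ (2 * p + 1)).trace.re
  set F : (κ → ℤˣ) → ℝ := fun ε => (H k * signSum H ε ^ (2 * p) * H k).trace.re
  have hsq : ∀ ε : κ → ℤˣ, ((ε k : ℤ) : ℝ) * ((ε k : ℤ) : ℝ) = 1 := by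
    intro ε; rcases Int.units_eq_one_or (ε k) with h | h <;> simp [h]
  have h1 : ∑ ε : κ → ℤˣ, ((ε k : ℤ) : ℝ) * t ε
      = ∑ ε : κ → ℤˣ, -((ε k : ℤ) : ℝ) * t (flipSign k ε) := by
    rw [← Equiv.sum_comp (flipSign k)]
    exact Finset.sum_congr rfl fun ε _ => by simp [flipSign_self]
  have hF : ∑ ε, F (flipSign k ε) = ∑ ε, F ε := Equiv.sum_comp _ _
  have h2 : ∀ ε : κ → ℤˣ, ((ε k : ℤ) : ℝ) * (t ε - t (flipSign k ε))
      ≤ 2 * (2 * p + 1) * (F ε + F (flipSign k ε)) := by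
    intro ε
    have h3 : t ε - t (flipSign k ε) = 2 * ((ε k : ℤ) : ℝ) * ∑ q ∈ Finset.range (2 * p + 1),
        (H k * signSum H ε ^ q * H k * signSum H (flipSign k ε) ^ (2 * p - q)).trace.re := by
      simp only [t]
      rw [← Complex.sub_re, ← Matrix.trace_sub, ← Matrix.mul_sub, pow_sub_pow_eq_sum,
        signSum_sub_flipSign, Finset.mul_sum, Matrix.trace_sum, Complex.re_sum, Finset.mul_sum]
      refine Finset.sum_congr rfl fun q _ => ?_
      rw [Nat.add_sub_cancel, Matrix.mul_smul, Matrix.smul_mul, Matrix.mul_smul, Matrix.trace_smul,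
        smul_eq_mul, ← Matrix.mul_assoc, ← Matrix.mul_assoc]
      have : (2 * ((ε k : ℤ) : ℂ)) = ((2 * ((ε k : ℤ) : ℝ) : ℝ) : ℂ) := by push_cast; ring
      rw [this, Complex.re_ofReal_mul]
    rw [h3]
    have h4 : ∑ q ∈ Finset.range (2 * p + 1),
        (H k * signSum H ε ^ q * H k * signSum H (flipSign k ε) ^ (2 * p - q)).trace.re
        ≤ ∑ q ∈ Finset.range (2 * p + 1), (F ε + F (flipSign k ε)) := by
      refine Finset.sum_le_sum fun q hq => ?_
      have := Finset.mem_range.mp hq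
      exact re_trace_mul_pow_mul_pow_le (hH k) (signSum_isHermitian hH _)
        (signSum_isHermitian hH _) (by omega)
    rw [Finset.sum_const, Finset.card_range, nsmul_eq_mul] at h4
    push_cast at h4
    calc _ = 2 * (((ε k : ℤ) : ℝ) * ((ε k : ℤ) : ℝ)) * ∑ q ∈ Finset.range (2 * p + 1),
        (H k * signSum H ε ^ q * H k * signSum H (flipSign k ε) ^ (2 * p - q)).trace.re := by ring
      _ ≤ _ := by rw [hsq]; linarith
  have h5 := Finset.sum_le_sum fun ε (_ : ε ∈ Finset.univ) => h2 ε
  rw [← Finset.mul_sum, Finset.sum_add_distrib, hF] at h5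
  have h6 : ∑ ε : κ → ℤˣ, ((ε k : ℤ) : ℝ) * (t ε - t (flipSign k ε))
      = 2 * ∑ ε : κ → ℤˣ, ((ε k : ℤ) : ℝ) * t ε := by
    rw [two_mul]; nth_rw 2 [h1]
    rw [← Finset.sum_add_distrib]
    exact Finset.sum_congr rfl fun ε _ => by ring
  linarith

/-- Expanding one factor of the power and integrating by parts yields Σ_k tr(H_k S^{2p} H_k), which
is at most c tr S^{2p} because c bounds Σ H_k² as a quadratic form. This is a recursion in p. -/
theorem sum_re_trace_signSum_pow_le {H : κ → Matrix I I ℂ} (hH : ∀ k, (H k).IsHermitian) {c : ℝ}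
    (hc0 : 0 ≤ c) (hc : ∀ v : I → ℂ, ∑ k, ∑ i, ‖(H k *ᵥ v) i‖ ^ 2 ≤ c * ∑ i, ‖v i‖ ^ 2) (p : ℕ) :
    ∑ ε : κ → ℤˣ, (signSum H ε ^ (2 * p)).trace.re
      ≤ (4 * p * c) ^ p * Fintype.card I * Fintype.card (κ → ℤˣ) := by
  have hstep : ∀ p : ℕ, ∑ ε : κ → ℤˣ, (signSum H ε ^ (2 * (p + 1))).trace.re
      ≤ 2 * (2 * p + 1) * c * ∑ ε : κ → ℤˣ, (signSum H ε ^ (2 * p)).trace.re := by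
    intro p
    calc _ = ∑ ε : κ → ℤˣ, ∑ k, ((ε k : ℤ) : ℝ) * (H k * signSum H ε ^ (2 * p + 1)).trace.re := by
          refine Finset.sum_congr rfl fun ε _ => ?_
          rw [show 2 * (p + 1) = (2 * p + 1) + 1 by ring, pow_succ']
          nth_rw 1 [signSum]
          rw [Finset.sum_mul, Matrix.trace_sum, Complex.re_sum]
          refine Finset.sum_congr rfl fun k _ => ?_
          rw [Matrix.smul_mul, Matrix.trace_smul, smul_eq_mul, ← Complex.ofReal_intCast,
            Complex.re_ofReal_mul]
      _ = ∑ k, ∑ ε : κ → ℤˣ, ((ε k : ℤ) : ℝ) * (H k * signSum H ε ^ (2 * p + 1)).trace.re :=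
          Finset.sum_comm
      _ ≤ ∑ k, 2 * (2 * p + 1) * ∑ ε : κ → ℤˣ, (H k * signSum H ε ^ (2 * p) * H k).trace.re :=
          Finset.sum_le_sum fun k _ => sum_sign_mul_re_trace_le hH p k
      _ = 2 * (2 * p + 1) * ∑ ε : κ → ℤˣ, ∑ k, (H k * signSum H ε ^ (2 * p) * H k).trace.re := by
          rw [← Finset.mul_sum, Finset.sum_comm]
      _ ≤ 2 * (2 * p + 1) * ∑ ε : κ → ℤˣ, c * (signSum H ε ^ (2 * p)).trace.re := by
          gcongr with ε
          set Y := signSum H ε ^ p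
          have hY : Yᴴ = Y := ((signSum_isHermitian hH ε).pow p).eq
          have hYY : signSum H ε ^ (2 * p) = Yᴴ * Y := by rw [hY, two_mul, pow_add]
          -- The trace is a Hilbert–Schmidt norm, so `hc` can be applied to each column of Y.
          have h1 : ∀ k, (H k * signSum H ε ^ (2 * p) * H k).trace.re
              = ∑ i, ∑ j, ‖(H k *ᵥ fun j => Y j i) j‖ ^ 2 := by
            intro k
            have : (H k * signSum H ε ^ (2 * p) * H k).trace = ((H k * Y)ᴴ * (H k * Y)).trace := by
              rw [hYY, Matrix.conjTranspose_mul, hY, (hH k).eq, Matrix.trace_mul_comm,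
                ← Matrix.mul_assoc, ← Matrix.mul_assoc, Matrix.trace_mul_comm]
              simp only [Matrix.mul_assoc]
            rw [this, re_trace_conjTranspose_mul_self]
            rfl
          simp_rw [h1]
          rw [hYY, re_trace_conjTranspose_mul_self, Finset.sum_comm, Finset.mul_sum]
          exact Finset.sum_le_sum fun i _ => hc fun j => Y j i
      _ = _ := by rw [← Finset.mul_sum, mul_assoc (2 * (2 * (p : ℝ) + 1))]
  have hnn : ∀ p, (0 : ℝ) ≤ ∑ ε : κ → ℤˣ, (signSum H ε ^ (2 * p)).trace.re := by
    intro p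
    refine Finset.sum_nonneg fun ε _ => ?_
    have hY : (signSum H ε ^ p)ᴴ = signSum H ε ^ p := ((signSum_isHermitian hH ε).pow p).eq
    rw [two_mul, pow_add]
    nth_rw 1 [← hY]
    rw [re_trace_conjTranspose_mul_self]
    positivity
  -- Below a fixed N every recursion factor 2(2p + 1) is at most 4N; at the end N = p.
  have main : ∀ N p : ℕ, p ≤ N → ∑ ε : κ → ℤˣ, (signSum H ε ^ (2 * p)).trace.re
      ≤ (4 * N * c) ^ p * (Fintype.card I * Fintype.card (κ → ℤˣ)) := by
    intro N p
    induction p with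
    | zero =>
      intro _
      simp [Matrix.trace_one, mul_comm]
    | succ p ih =>
      intro hp
      refine (hstep p).trans ?_
      have hpN : (p : ℝ) + 1 ≤ N := by exact_mod_cast hp
      calc _ ≤ (4 * N * c) * ∑ ε : κ → ℤˣ, (signSum H ε ^ (2 * p)).trace.re := by
            refine mul_le_mul_of_nonneg_right ?_ (hnn p)
            exact mul_le_mul_of_nonneg_right (by linarith) hc0
        _ ≤ (4 * N * c) * ((4 * N * c) ^ p * (Fintype.card I * Fintype.card (κ → ℤˣ))) := by
            gcongr; exact ih (by omega)
        _ = _ := by ring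
  rw [mul_assoc]
  exact main p p le_rfl

variable {J : Type*} [Fintype J] [DecidableEq J]

/-- The matrices `A_k` side by side. -/
def sideBySide (A : κ → Matrix I J ℂ) : Matrix I (J × κ) ℂ := Matrix.of fun i x => A x.2 i x.1

/-- The matrices `A_k` on top of each other. -/
def stacked (A : κ → Matrix I J ℂ) : Matrix (I × κ) J ℂ := Matrix.of fun x j => A x.2 x.1 j

theorem signSum_apply (A : κ → Matrix I J ℂ) (ε : κ → ℤˣ) (i : I) (j : J) :
    signSum A ε i j = ∑ k, ((ε k : ℤ) : ℂ) * A k i j := by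
  simp [signSum, Matrix.sum_apply]

/-- Hermitian dilation: for the blocks (0, A_k; A_kᴴ, 0), the sum of squares is block diagonal with
blocks Σ A_k A_kᴴ and Σ A_kᴴ A_k, of norms ‖`sideBySide A`‖² and ‖`stacked A`‖². -/
theorem sum_opNorm_signSum_pow_le (A : κ → Matrix I J ℂ) {p : ℕ} (hp : p ≠ 0) :
    ∑ ε : κ → ℤˣ, ‖signSum A ε‖ ^ (2 * p)
      ≤ (4 * p) ^ p * (Fintype.card I + Fintype.card J)
        * (‖sideBySide A‖ ^ (2 * p) + ‖stacked A‖ ^ (2 * p)) * Fintype.card (κ → ℤˣ) := by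
  set H : κ → Matrix (I ⊕ J) (I ⊕ J) ℂ := fun k => Matrix.fromBlocks 0 (A k) (A k)ᴴ 0
  have hH : ∀ k, (H k).IsHermitian := fun k => by
    simp [H, Matrix.IsHermitian, Matrix.fromBlocks_conjTranspose]
  set c : ℝ := max (‖sideBySide A‖ ^ 2) (‖stacked A‖ ^ 2)
  have hc : ∀ v : I ⊕ J → ℂ, ∑ k, ∑ i, ‖(H k *ᵥ v) i‖ ^ 2 ≤ c * ∑ i, ‖v i‖ ^ 2 := by
    intro v
    have h1 : ∑ k, ∑ i, ‖(A k *ᵥ (v ∘ Sum.inr)) i‖ ^ 2 ≤ c * ∑ j, ‖v (Sum.inr j)‖ ^ 2 := by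
      have h := sum_norm_sq_mulVec_le (stacked A) (v ∘ Sum.inr)
      rw [Fintype.sum_prod_type, Finset.sum_comm] at h
      refine le_trans h ?_
      exact mul_le_mul_of_nonneg_right (le_max_right _ _) (by positivity)
    have h2 : ∑ k, ∑ j, ‖((A k)ᴴ *ᵥ (v ∘ Sum.inl)) j‖ ^ 2 ≤ c * ∑ i, ‖v (Sum.inl i)‖ ^ 2 := by
      have h := sum_norm_sq_mulVec_le (sideBySide A)ᴴ (v ∘ Sum.inl)
      rw [Fintype.sum_prod_type, Finset.sum_comm, Matrix.l2_opNorm_conjTranspose] at h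
      refine le_trans h ?_
      exact mul_le_mul_of_nonneg_right (le_max_left _ _) (by positivity)
    calc _ = ∑ k, (∑ i, ‖(A k *ᵥ (v ∘ Sum.inr)) i‖ ^ 2
          + ∑ j, ‖((A k)ᴴ *ᵥ (v ∘ Sum.inl)) j‖ ^ 2) := by
          refine Finset.sum_congr rfl fun k _ => ?_
          rw [Fintype.sum_sum_type]
          simp [H, Matrix.fromBlocks_mulVec]
      _ ≤ _ := by
          rw [Finset.sum_add_distrib, Fintype.sum_sum_type]
          linarith
  have h := sum_re_trace_signSum_pow_le hH (le_max_of_le_left (by positivity)) hc p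
  have hsum : ∀ ε : κ → ℤˣ, ‖signSum A ε‖ ^ (2 * p) ≤ (signSum H ε ^ (2 * p)).trace.re := by
    intro ε
    refine le_trans (pow_le_pow_left₀ (norm_nonneg _) ?_ _)
      (opNorm_pow_le_re_trace (signSum_isHermitian hH ε) hp)
    have : signSum A ε = (signSum H ε).submatrix Sum.inl Sum.inr := by
      ext i j
      rw [Matrix.submatrix_apply, signSum_apply, signSum_apply]
      simp [H]
    rw [this]
    exact opNorm_submatrix_le _ Sum.inl_injective Sum.inr_injective
  refine (Finset.sum_le_sum fun ε _ => hsum ε).trans (h.trans ?_)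
  -- The maximum is relaxed to a sum so that the two terms can be averaged separately in the
  -- iteration over slots.
  have hcp : c ^ p ≤ ‖sideBySide A‖ ^ (2 * p) + ‖stacked A‖ ^ (2 * p) := by
    rw [pow_mul, pow_mul]
    rcases max_choice (‖sideBySide A‖ ^ 2) (‖stacked A‖ ^ 2) with hm | hm
    · rw [show c = _ from hm]; exact le_add_of_nonneg_right (by positivity)
    · rw [show c = _ from hm]; exact le_add_of_nonneg_left (by positivity)
  rw [mul_pow, Fintype.card_sum]
  push_cast
  calc _ = (4 * (p : ℝ)) ^ p * (Fintype.card I + Fintype.card J) * c ^ p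
        * Fintype.card (κ → ℤˣ) := by ring
    _ ≤ _ := by gcongr

end Khintchine

/-! ### Decoupled Rademacher chaos with matrix coefficients -/

section Chaos

variable {A : Type*} {κ I J : Type}

/-- The vector `k` with `k j = x j` where `B j` holds and `k j = y j` elsewhere. -/
def join (B : A → Bool) (x : {j // B j = true} → κ) (y : {j // B j = false} → κ) : A → κ :=
  fun j => if h : B j = true then x ⟨j, h⟩ else y ⟨j, by simpa using h⟩

/-- The matrix of `T` in which the slots `j` with `B j` are row indices and the other ones are
column indices. -/
def flatten (T : (A → κ) → Matrix I J ℂ) (B : A → Bool) :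
    Matrix (I × ({j // B j = true} → κ)) (J × ({j // B j = false} → κ)) ℂ :=
  Matrix.of fun x y => T (join B x.2 y.2) x.1 y.1

/-- The decoupled chaos `∑_k ∏_j ε_j(k_j) T_k`. -/
noncomputable def chaos [Fintype A] [DecidableEq A] [Fintype κ]
    (T : (A → κ) → Matrix I J ℂ) (ε : A → κ → ℤˣ) : Matrix I J ℂ :=
  ∑ k, (∏ j, ((ε j (k j) : ℤ) : ℂ)) • T k

theorem chaos_apply [Fintype A] [DecidableEq A] [Fintype κ]
    (T : (A → κ) → Matrix I J ℂ) (ε : A → κ → ℤˣ) (i : I) (j : J) :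
    chaos T ε i j = ∑ k, (∏ a, ((ε a (k a) : ℤ) : ℂ)) * T k i j := by
  simp [chaos, Matrix.sum_apply]

theorem join_cons_false {s : ℕ} (B : Fin s → Bool) (x : {j // B j = true} → κ)
    (y : {j // B j = false} → κ) (k : κ) :
    (Fin.cons k (join B x y) : Fin (s + 1) → κ)
      = join (Fin.cons false B : Fin (s + 1) → Bool)
        (fun j => Fin.cases (motive := fun i => (Fin.cons false B : Fin (s + 1) → Bool) i = true → κ)
          (fun h => absurd h (by simp)) (fun t h => x ⟨t, h⟩) j.1 j.2)
        (fun j => Fin.cases (motive := fun i => (Fin.cons false B : Fin (s + 1) → Bool) i = false → κ)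
          (fun _ => k) (fun t h => y ⟨t, h⟩) j.1 j.2) := by
  funext j
  refine Fin.cases ?_ (fun t => ?_) j
  · simp [join]
  · simp only [Fin.cons_succ, join, Fin.cases_succ]

theorem join_cons_true {s : ℕ} (B : Fin s → Bool) (x : {j // B j = true} → κ)
    (y : {j // B j = false} → κ) (k : κ) :
    (Fin.cons k (join B x y) : Fin (s + 1) → κ)
      = join (Fin.cons true B : Fin (s + 1) → Bool)
        (fun j => Fin.cases (motive := fun i => (Fin.cons true B : Fin (s + 1) → Bool) i = true → κ)
          (fun _ => k) (fun t h => x ⟨t, h⟩) j.1 j.2)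
        (fun j => Fin.cases (motive := fun i => (Fin.cons true B : Fin (s + 1) → Bool) i = false → κ)
          (fun h => absurd h (by simp)) (fun t h => y ⟨t, h⟩) j.1 j.2) := by
  funext j
  refine Fin.cases ?_ (fun t => ?_) j
  · simp [join]
  · simp only [Fin.cons_succ, join, Fin.cases_succ]

variable [Fintype κ] [DecidableEq κ] [Fintype I] [DecidableEq I] [Fintype J] [DecidableEq J]

/-- Placing the matrices side by side declares slot 0 a column index, so flattening the other slots
along B gives a reindexing of the flattening along `Fin.cons false B`. Stacking is the same with
rows and `true`. -/
theorem opNorm_flatten_sideBySide_le {s : ℕ} (T : (Fin (s + 1) → κ) → Matrix I J ℂ)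
    (B : Fin s → Bool) :
    ‖flatten (fun k' : Fin s → κ => sideBySide fun k => T (Fin.cons k k')) B‖
      ≤ ‖flatten T (Fin.cons false B)‖ := by
  let φ : I × ({j // B j = true} → κ)
      → I × ({j // (Fin.cons false B : Fin (s + 1) → Bool) j = true} → κ) := fun x =>
    (x.1, fun j => Fin.cases
      (motive := fun i => (Fin.cons false B : Fin (s + 1) → Bool) i = true → κ)
      (fun h => absurd h (by simp)) (fun t h => x.2 ⟨t, h⟩) j.1 j.2)
  let ψ : (J × κ) × ({j // B j = false} → κ)
      → J × ({j // (Fin.cons false B : Fin (s + 1) → Bool) j = false} → κ) := fun y =>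
    (y.1.1, fun j => Fin.cases
      (motive := fun i => (Fin.cons false B : Fin (s + 1) → Bool) i = false → κ)
      (fun _ => y.1.2) (fun t h => y.2 ⟨t, h⟩) j.1 j.2)
  have hφ : φ.Injective := fun x x' h => by
    refine Prod.ext (congrArg Prod.fst h :) (funext fun t => ?_)
    exact congrFun (congrArg Prod.snd h) ⟨Fin.succ t.1, t.2⟩
  have hψ : ψ.Injective := fun y y' h => by
    refine Prod.ext (Prod.ext (congrArg Prod.fst h :) ?_) (funext fun t => ?_)
    · exact congrFun (congrArg Prod.snd h) ⟨0, rfl⟩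
    · exact congrFun (congrArg Prod.snd h) ⟨Fin.succ t.1, t.2⟩
  have : flatten (fun k' : Fin s → κ => sideBySide fun k => T (Fin.cons k k')) B
      = (flatten T (Fin.cons false B)).submatrix φ ψ := by
    ext x y
    simp only [flatten, sideBySide, Matrix.of_apply, Matrix.submatrix_apply, φ, ψ]
    rw [join_cons_false]
  rw [this]
  exact opNorm_submatrix_le _ hφ hψ

theorem opNorm_flatten_stacked_le {s : ℕ} (T : (Fin (s + 1) → κ) → Matrix I J ℂ)
    (B : Fin s → Bool) :
    ‖flatten (fun k' : Fin s → κ => stacked fun k => T (Fin.cons k k')) B‖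
      ≤ ‖flatten T (Fin.cons true B)‖ := by
  let φ : (I × κ) × ({j // B j = true} → κ)
      → I × ({j // (Fin.cons true B : Fin (s + 1) → Bool) j = true} → κ) := fun x =>
    (x.1.1, fun j => Fin.cases
      (motive := fun i => (Fin.cons true B : Fin (s + 1) → Bool) i = true → κ)
      (fun _ => x.1.2) (fun t h => x.2 ⟨t, h⟩) j.1 j.2)
  let ψ : J × ({j // B j = false} → κ)
      → J × ({j // (Fin.cons true B : Fin (s + 1) → Bool) j = false} → κ) := fun y =>
    (y.1, fun j => Fin.cases
      (motive := fun i => (Fin.cons true B : Fin (s + 1) → Bool) i = false → κ)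
      (fun h => absurd h (by simp)) (fun t h => y.2 ⟨t, h⟩) j.1 j.2)
  have hψ : ψ.Injective := fun x x' h => by
    refine Prod.ext (congrArg Prod.fst h :) (funext fun t => ?_)
    exact congrFun (congrArg Prod.snd h) ⟨Fin.succ t.1, t.2⟩
  have hφ : φ.Injective := fun y y' h => by
    refine Prod.ext (Prod.ext (congrArg Prod.fst h :) ?_) (funext fun t => ?_)
    · exact congrFun (congrArg Prod.snd h) ⟨0, rfl⟩
    · exact congrFun (congrArg Prod.snd h) ⟨Fin.succ t.1, t.2⟩
  have : flatten (fun k' : Fin s → κ => stacked fun k => T (Fin.cons k k')) B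
      = (flatten T (Fin.cons true B)).submatrix φ ψ := by
    ext x y
    simp only [flatten, stacked, Matrix.of_apply, Matrix.submatrix_apply, φ, ψ]
    rw [join_cons_true]
  rw [this]
  exact opNorm_submatrix_le _ hφ hψ

omit [DecidableEq κ] [Fintype I] [DecidableEq I] [Fintype J] [DecidableEq J] in
theorem chaos_cons {s : ℕ} (T : (Fin (s + 1) → κ) → Matrix I J ℂ) (ε₀ : κ → ℤˣ)
    (ε : Fin s → κ → ℤˣ) :
    chaos T (Fin.cons ε₀ ε : Fin (s + 1) → κ → ℤˣ)
      = signSum (fun k => chaos (fun k' => T (Fin.cons k k')) ε) ε₀ := by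
  unfold chaos signSum
  rw [← (Fin.consEquiv fun _ => κ).sum_comp, Fintype.sum_prod_type]
  refine Finset.sum_congr rfl fun k _ => ?_
  rw [Finset.smul_sum]
  refine Finset.sum_congr rfl fun k' _ => ?_
  simp [Fin.prod_univ_succ, mul_smul, Fin.consEquiv]

/-- The moments of a decoupled Rademacher chaos are controlled by the norms of the flattenings. -/
theorem sum_opNorm_chaos_fin_pow_le {p : ℕ} (hp : p ≠ 0) {R D : ℝ} (s : ℕ) :
    ∀ {I J : Type} [Fintype I] [DecidableEq I] [Fintype J] [DecidableEq J]
      (T : (Fin s → κ) → Matrix I J ℂ),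
      (Fintype.card I + Fintype.card J : ℝ) * (Fintype.card κ + 1) ^ s ≤ D →
      (∀ B, ‖flatten T B‖ ≤ R) →
      ∑ ε : Fin s → κ → ℤˣ, ‖chaos T ε‖ ^ (2 * p)
        ≤ (2 * D * (4 * p) ^ p) ^ s * R ^ (2 * p) * Fintype.card (Fin s → κ → ℤˣ) := by
  induction s with
  | zero =>
    intro I J _ _ _ _ T _ hR
    have hT : ∀ ε, ‖chaos T ε‖ ≤ R := by
      intro ε
      refine le_trans (le_of_eq ?_) ((opNorm_submatrix_le (flatten T isEmptyElim)
        (f := fun i => (i, fun j => isEmptyElim j.1)) (g := fun i => (i, fun j => isEmptyElim j.1))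
        (fun _ _ h => (congrArg Prod.fst h :)) (fun _ _ h => (congrArg Prod.fst h :))).trans (hR _))
      congr 1
      ext i j
      rw [chaos_apply, Fintype.sum_unique]
      simp only [Finset.univ_eq_empty, Finset.prod_empty, one_mul, flatten, Matrix.submatrix_apply,
        Matrix.of_apply]
      congr!
    calc _ ≤ ∑ ε : Fin 0 → κ → ℤˣ, R ^ (2 * p) :=
          Finset.sum_le_sum fun ε _ => pow_le_pow_left₀ (norm_nonneg _) (hT ε) _
      _ = _ := by simp
  | succ s ih =>
    intro I J _ _ _ _ T hD hR
    have hq : (1 : ℝ) ≤ (Fintype.card κ + 1) ^ s := one_le_pow₀ (by simp)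
    -- The index types change at each step while D stays fixed: turning a slot into an index
    -- multiplies one dimension by |κ|, which one of the factors |κ| + 1 pays for.
    have hD1 : (Fintype.card (J × κ) + Fintype.card I : ℝ) * (Fintype.card κ + 1) ^ s ≤ D := by
      refine le_trans ?_ hD
      rw [pow_succ, Fintype.card_prod, ← mul_assoc, mul_right_comm]
      push_cast
      gcongr
      nlinarith [(Nat.cast_nonneg (Fintype.card I) : (0:ℝ) ≤ _),
        (Nat.cast_nonneg (Fintype.card J) : (0:ℝ) ≤ _),
        (Nat.cast_nonneg (Fintype.card κ) : (0:ℝ) ≤ _), mul_nonneg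
        (Nat.cast_nonneg (Fintype.card I) : (0:ℝ) ≤ _)
        (Nat.cast_nonneg (Fintype.card κ) : (0:ℝ) ≤ _)]
    have hD2 : (Fintype.card (I × κ) + Fintype.card J : ℝ) * (Fintype.card κ + 1) ^ s ≤ D := by
      refine le_trans ?_ hD
      rw [pow_succ, Fintype.card_prod, ← mul_assoc, mul_right_comm]
      push_cast
      gcongr
      nlinarith [(Nat.cast_nonneg (Fintype.card I) : (0:ℝ) ≤ _),
        (Nat.cast_nonneg (Fintype.card J) : (0:ℝ) ≤ _),
        (Nat.cast_nonneg (Fintype.card κ) : (0:ℝ) ≤ _), mul_nonneg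
        (Nat.cast_nonneg (Fintype.card J) : (0:ℝ) ≤ _)
        (Nat.cast_nonneg (Fintype.card κ) : (0:ℝ) ≤ _)]
    have hD0 : (Fintype.card I + Fintype.card J : ℝ) ≤ D := by
      refine le_trans ?_ hD
      exact le_mul_of_one_le_right (by positivity) (one_le_pow₀ (by simp))
    have hDn : 0 ≤ D := le_trans (by positivity) hD0
    have h1 := ih (fun k' : Fin s → κ => sideBySide fun k => T (Fin.cons k k'))
      (by rw [add_comm (Fintype.card I : ℝ)]; exact hD1)
      (fun B => (opNorm_flatten_sideBySide_le T B).trans (hR _))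
    have h2 := ih (fun k' : Fin s → κ => stacked fun k => T (Fin.cons k k')) hD2
      (fun B => (opNorm_flatten_stacked_le T B).trans (hR _))
    have hside : ∀ ε : Fin s → κ → ℤˣ,
        sideBySide (fun k => chaos (fun k' => T (Fin.cons k k')) ε)
          = chaos (fun k' : Fin s → κ => sideBySide fun k => T (Fin.cons k k')) ε := by
      intro ε; ext i j; simp only [sideBySide, Matrix.of_apply, chaos_apply]
    have hstack : ∀ ε : Fin s → κ → ℤˣ,
        stacked (fun k => chaos (fun k' => T (Fin.cons k k')) ε)
          = chaos (fun k' : Fin s → κ => stacked fun k => T (Fin.cons k k')) ε := by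
      intro ε; ext i j; simp only [stacked, Matrix.of_apply, chaos_apply]
    calc ∑ ε : Fin (s + 1) → κ → ℤˣ, ‖chaos T ε‖ ^ (2 * p)
        = ∑ ε : Fin s → κ → ℤˣ, ∑ ε₀ : κ → ℤˣ,
          ‖signSum (fun k => chaos (fun k' => T (Fin.cons k k')) ε) ε₀‖ ^ (2 * p) := by
          rw [← (Fin.consEquiv fun _ => κ → ℤˣ).sum_comp, Fintype.sum_prod_type, Finset.sum_comm]
          refine Finset.sum_congr rfl fun ε _ => Finset.sum_congr rfl fun ε₀ _ => ?_
          rw [← chaos_cons]; rfl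
      _ ≤ ∑ ε : Fin s → κ → ℤˣ, (4 * p) ^ p * D
          * (‖chaos (fun k' : Fin s → κ => sideBySide fun k => T (Fin.cons k k')) ε‖ ^ (2 * p)
            + ‖chaos (fun k' : Fin s → κ => stacked fun k => T (Fin.cons k k')) ε‖ ^ (2 * p))
          * Fintype.card (κ → ℤˣ) := by
          refine Finset.sum_le_sum fun ε _ => ?_
          have := sum_opNorm_signSum_pow_le (fun k => chaos (fun k' => T (Fin.cons k k')) ε) hp
          rw [hside, hstack] at this
          refine this.trans ?_
          gcongr
      _ = (4 * p) ^ p * D * ((∑ ε : Fin s → κ → ℤˣ,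
            ‖chaos (fun k' : Fin s → κ => sideBySide fun k => T (Fin.cons k k')) ε‖ ^ (2 * p))
          + ∑ ε : Fin s → κ → ℤˣ,
            ‖chaos (fun k' : Fin s → κ => stacked fun k => T (Fin.cons k k')) ε‖ ^ (2 * p))
          * Fintype.card (κ → ℤˣ) := by
          rw [← Finset.sum_mul, ← Finset.mul_sum, Finset.sum_add_distrib]
      _ ≤ (4 * p) ^ p * D *
          ((2 * D * (4 * p) ^ p) ^ s * R ^ (2 * p) * Fintype.card (Fin s → κ → ℤˣ)
          + (2 * D * (4 * p) ^ p) ^ s * R ^ (2 * p) * Fintype.card (Fin s → κ → ℤˣ))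
          * Fintype.card (κ → ℤˣ) := by gcongr
      _ = _ := by
          have : Fintype.card (Fin (s + 1) → κ → ℤˣ)
              = Fintype.card (κ → ℤˣ) * Fintype.card (Fin s → κ → ℤˣ) := by
            rw [← Fintype.card_prod]
            exact (Fintype.card_congr (Fin.consEquiv fun _ => κ → ℤˣ)).symm
          rw [this]
          push_cast
          ring

theorem sum_opNorm_chaos_pow_le [Fintype A] [DecidableEq A] {p : ℕ} (hp : p ≠ 0) {R D : ℝ}
    (T : (A → κ) → Matrix I J ℂ)
    (hD : (Fintype.card I + Fintype.card J : ℝ) * (Fintype.card κ + 1) ^ Fintype.card A ≤ D)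
    (hR : ∀ B, ‖flatten T B‖ ≤ R) :
    ∑ ε : A → κ → ℤˣ, ‖chaos T ε‖ ^ (2 * p)
      ≤ (2 * D * (4 * p) ^ p) ^ Fintype.card A * R ^ (2 * p) * Fintype.card (A → κ → ℤˣ) := by
  set e : A ≃ Fin (Fintype.card A) := Fintype.equivFin A
  have h := sum_opNorm_chaos_fin_pow_le hp (Fintype.card A)
    (fun k : Fin (Fintype.card A) → κ => T (k ∘ e)) hD fun B => by
      let φ : I × ({j // B j = true} → κ) → I × ({j // (B ∘ e) j = true} → κ) :=
        fun x => (x.1, fun j => x.2 ⟨e j.1, j.2⟩)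
      let ψ : J × ({j // B j = false} → κ) → J × ({j // (B ∘ e) j = false} → κ) :=
        fun x => (x.1, fun j => x.2 ⟨e j.1, j.2⟩)
      have hφ : φ.Injective := fun x x' h => by
        refine Prod.ext (congrArg Prod.fst h :) (funext fun t => ?_)
        have := congrFun (congrArg Prod.snd h) ⟨e.symm t.1, by simpa using t.2⟩
        simpa [φ] using this
      have hψ : ψ.Injective := fun x x' h => by
        refine Prod.ext (congrArg Prod.fst h :) (funext fun t => ?_)
        have := congrFun (congrArg Prod.snd h) ⟨e.symm t.1, by simpa using t.2⟩
        simpa [ψ] using this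
      exact (opNorm_submatrix_le (flatten T (B ∘ e)) hφ hψ).trans (hR _)
  rw [← (Equiv.arrowCongr e (Equiv.refl (κ → ℤˣ))).sum_comp,
    ← Fintype.card_congr (Equiv.arrowCongr e (Equiv.refl (κ → ℤˣ)))] at h
  refine le_trans (le_of_eq (Finset.sum_congr rfl fun ε _ => ?_)) h
  congr 2
  unfold chaos
  rw [← (Equiv.arrowCongr e (Equiv.refl κ)).sum_comp]
  refine Finset.sum_congr rfl fun k _ => ?_
  congr 1
  · rw [← e.prod_comp]
    simp
  · congr 1
    ext j; simp

end Chaos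

/-! ### Schur contractions of tensors -/

section Schur

variable {A : Type*} {κ I J : Type} [Fintype A] [DecidableEq A]
variable [Fintype κ] [DecidableEq κ] [Fintype I] [DecidableEq I] [Fintype J] [DecidableEq J]

/-- For any B, a product of functions of single slots factors into a function of the row slots times
one of the column slots, hence acts by diagonal contractions. -/
theorem opNorm_flatten_prod_smul_le (T : (A → κ) → Matrix I J ℂ) {c : A → κ → ℂ}
    (hc : ∀ j l, ‖c j l‖ ≤ 1) (B : A → Bool) :
    ‖flatten (fun k => (∏ j, c j (k j)) • T k) B‖ ≤ ‖flatten T B‖ := by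
  have hle : ∀ (P : A → Prop) [DecidablePred P] (x : {j // P j} → κ),
      ‖∏ j : {j // P j}, c j.1 (x j)‖ ≤ 1 := fun P _ x => by
    rw [norm_prod]
    exact Finset.prod_le_one (fun _ _ => norm_nonneg _) fun _ _ => hc _ _
  have h := opNorm_scale_le (flatten T B)
    (u := fun x => ∏ j : {j // B j = true}, c j.1 (x.2 j))
    (v := fun y => ∏ j : {j // B j = false}, c j.1 (y.2 j))
    (fun x => hle _ x.2) (fun y => hle _ y.2)
  refine le_trans (le_of_eq ?_) h
  congr 1
  ext x y
  simp only [flatten, Matrix.of_apply, Matrix.smul_apply, smul_eq_mul]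
  have h1 : ∏ j, c j (join B x.2 y.2 j) = (∏ j : {j // B j = true}, c j.1 (x.2 j))
      * ∏ j : {j // B j = false}, c j.1 (y.2 j) := by
    rw [← Finset.prod_filter_mul_prod_filter_not Finset.univ (fun j => B j = true)]
    congr 1
    · rw [Finset.prod_subtype (p := fun j => B j = true) _ (by simp)]
      exact Finset.prod_congr rfl fun j _ => by simp [join, j.2]
    · rw [Finset.prod_subtype (p := fun j => B j = false) _ (by simp)]
      exact Finset.prod_congr rfl fun j _ => by simp [join, j.2]
  rw [h1]
  ring

/-- If a and b lie on opposite sides, the cutoff is a pinching by their common value. On the same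
side it deletes rows or columns, which is a pinching by a Boolean label compared with the constant
`true`. -/
theorem opNorm_flatten_ite_eq_le (T : (A → κ) → Matrix I J ℂ) (a b : A) (B : A → Bool) :
    ‖flatten (fun k => if k a = k b then T k else 0) B‖ ≤ ‖flatten T B‖ := by
  have key : ∀ {t : Type} [DecidableEq t] (φ : ({j // B j = true} → κ) → t)
      (ψ : ({j // B j = false} → κ) → t),
      (∀ x y, join B x y a = join B x y b ↔ φ x = ψ y) →
      ‖flatten (fun k => if k a = k b then T k else 0) B‖ ≤ ‖flatten T B‖ := by
    intro t _ φ ψ h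
    refine le_trans (le_of_eq ?_) (opNorm_pinching_le (flatten T B)
      (fun x => φ x.2) (fun y => ψ y.2))
    congr 1
    ext x y
    simp only [flatten, Matrix.of_apply, h]
    split_ifs <;> rfl
  by_cases ha : B a = true <;> by_cases hb : B b = true
  · exact key (fun x => decide (x ⟨a, ha⟩ = x ⟨b, hb⟩)) (fun _ => true)
      fun x y => by simp [join, ha, hb]
  · exact key (fun x => x ⟨a, ha⟩) (fun y => y ⟨b, by simpa using hb⟩)
      fun x y => by simp [join, ha, hb]
  · exact key (fun x => x ⟨b, hb⟩) (fun y => y ⟨a, by simpa using ha⟩)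
      fun x y => by simp [join, ha, hb, eq_comm (a := y _)]
  · exact key (fun _ => true)
      (fun y => decide (y ⟨a, by simpa using ha⟩ = y ⟨b, by simpa using hb⟩))
      fun x y => by simp [join, ha, hb]

/-- The vectors `k` which are coloured by `f` according to the pattern `g`. -/
def Follows (g : A → A) (f : κ → Option A) (k : A → κ) : Prop :=
  (∀ j, f (k j) = some (g j)) ∧ ∀ j, k (g j) = k j

instance (g : A → A) (f : κ → Option A) (k : A → κ) : Decidable (Follows g f k) := by
  unfold Follows; infer_instance

/-- The part of the tensor `T` which follows the pattern `g` and the colouring `f`. -/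
def restrictPattern (g : A → A) (f : κ → Option A) (T : (A → κ) → Matrix I J ℂ) :
    (A → κ) → Matrix I J ℂ :=
  fun k => if Follows g f k then T k else 0

/-- The indicator of `Follows` is a product of one-slot colour cutoffs and of equality cutoffs
between two slots, each harmless by itself. -/
theorem opNorm_flatten_restrictPattern_le (g : A → A) (f : κ → Option A)
    (T : (A → κ) → Matrix I J ℂ) (B : A → Bool) :
    ‖flatten (restrictPattern g f T) B‖ ≤ ‖flatten T B‖ := by
  have h1 : ∀ F : Finset A,
      ‖flatten (fun k => if ∀ j ∈ F, k (g j) = k j then T k else 0) B‖ ≤ ‖flatten T B‖ := by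
    intro F
    induction F using Finset.induction_on with
    | empty => simp
    | insert a F _ ih =>
      refine le_trans (le_of_eq ?_) ((opNorm_flatten_ite_eq_le
        (fun k => if ∀ j ∈ F, k (g j) = k j then T k else 0) (g a) a B).trans ih)
      congr 2
      funext k
      by_cases h : k (g a) = k a <;> simp [h]
  refine le_trans (le_of_eq ?_) ((opNorm_flatten_prod_smul_le
    (fun k => if ∀ j ∈ Finset.univ, k (g j) = k j then T k else 0)
    (c := fun j l => if f l = some (g j) then 1 else 0)
    (fun j l => by split_ifs <;> simp) B).trans (h1 Finset.univ))
  congr 2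
  funext k
  rw [restrictPattern, Fintype.prod_ite_zero]
  by_cases h : ∀ j, f (k j) = some (g j)
  · by_cases h' : ∀ j, k (g j) = k j <;> simp [Follows, h, h']
  · simp [Follows, h]

end Schur

/-! ### Decoupling by random colourings -/

section Decoupling

variable {A : Type*} {κ I J : Type} [Fintype A] [DecidableEq A]
variable [Fintype κ] [DecidableEq κ]

/-- A choice of representatives of the level sets of `k`, which only depends on these level sets. -/
noncomputable def levelRep (k : A → κ) (j : A) : A :=
  Classical.choose (⟨j, rfl⟩ : ∃ i, k i = k j)

omit [Fintype A] [DecidableEq A] [Fintype κ] [DecidableEq κ] in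
theorem apply_levelRep (k : A → κ) (j : A) : k (levelRep k j) = k j :=
  Classical.choose_spec (⟨j, rfl⟩ : ∃ i, k i = k j)

omit [Fintype A] [DecidableEq A] [Fintype κ] [DecidableEq κ] in
-- Equal level sets make the predicates handed to `Classical.choose` equal, hence also the choices.
theorem levelRep_congr {k k' : A → κ} (h : ∀ i j, k i = k j ↔ k' i = k' j) :
    levelRep k = levelRep k' := by
  funext j
  have : (fun i => k i = k j) = fun i => k' i = k' j := funext fun i => propext (h i j)
  unfold levelRep
  congr!

omit [Fintype A] [DecidableEq A] [Fintype κ] [DecidableEq κ] in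
theorem levelRep_eq_iff (k : A → κ) (i j : A) : levelRep k i = levelRep k j ↔ k i = k j := by
  constructor
  · intro h
    have := apply_levelRep k i
    rw [h] at this
    exact this.symm.trans (apply_levelRep k j)
  · intro h
    have : (fun a => k a = k i) = fun a => k a = k j := by simp [h]
    unfold levelRep
    congr!

omit [Fintype A] [DecidableEq A] [Fintype κ] [DecidableEq κ] in
-- Slots in different classes have different colours, hence different values: a vector following a
-- pattern has no further coincidences.
theorem Follows.levelRep_eq {k₀ k : A → κ} {f : κ → Option A} (h : Follows (levelRep k₀) f k) :
    levelRep k = levelRep k₀ := by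
  refine levelRep_congr fun i j => ?_
  refine Iff.trans ?_ (levelRep_eq_iff k₀ i j)
  constructor
  · intro hk
    have := h.1 i
    rw [hk, h.1 j] at this
    exact (Option.some_injective _ this).symm
  · intro hg
    rw [← h.2 i, hg, h.2 j]

/-- Following its own pattern prescribes the colour at each value taken by k and leaves the card A +
1 options free at every other point. -/
theorem card_colorings (k : A → κ) :
    (Finset.univ.filter fun f : κ → Option A => Follows (levelRep k) f k).card
      * (Fintype.card A + 1) ^ (Finset.univ.image (levelRep k)).card
      = Fintype.card (κ → Option A) := by
  classical
  have hpi : (Finset.univ.filter fun f : κ → Option A => Follows (levelRep k) f k)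
      = Fintype.piFinset fun l => if l ∈ Finset.univ.image k
          then Finset.univ.filter (fun o => ∀ j, k j = l → o = some (levelRep k j))
          else Finset.univ := by
    ext f
    simp only [Finset.mem_filter, Finset.mem_univ, true_and, Fintype.mem_piFinset, Follows,
      apply_levelRep, implies_true, and_true]
    constructor
    · intro h l
      split_ifs
      · simp only [Finset.mem_filter, Finset.mem_univ, true_and]
        rintro j rfl; exact h j
      · simp
    · intro h j
      have := h (k j)
      rw [if_pos (by simp)] at this
      exact (Finset.mem_filter.mp this).2 j rfl
  have hone : ∀ l ∈ Finset.univ.image k,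
      (Finset.univ.filter (fun o : Option A => ∀ j, k j = l → o = some (levelRep k j))).card = 1 := by
    intro l hl
    obtain ⟨j, -, rfl⟩ := Finset.mem_image.mp hl
    rw [Finset.card_eq_one]
    refine ⟨some (levelRep k j), ?_⟩
    ext o
    simp only [Finset.mem_filter, Finset.mem_univ, true_and, Finset.mem_singleton]
    constructor
    · intro h; exact h j rfl
    · rintro rfl i hi; rw [(levelRep_eq_iff k i j).mpr hi]
  have himg : (Finset.univ.image (levelRep k)).card = (Finset.univ.image k).card := by
    have : Finset.univ.image k = (Finset.univ.image (levelRep k)).image k := by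
      rw [Finset.image_image]
      exact Finset.image_congr fun j _ => (apply_levelRep k j).symm
    rw [this]
    refine (Finset.card_image_of_injOn ?_).symm
    intro a ha b hb hab
    obtain ⟨i, -, rfl⟩ := Finset.mem_image.mp (Finset.mem_coe.mp ha)
    obtain ⟨j, -, rfl⟩ := Finset.mem_image.mp (Finset.mem_coe.mp hb)
    simp only [apply_levelRep] at hab
    exact (levelRep_eq_iff k i j).mpr hab
  rw [hpi, Fintype.card_piFinset, himg]
  have : ∀ l, (if l ∈ Finset.univ.image k
          then Finset.univ.filter (fun o => ∀ j, k j = l → o = some (levelRep k j))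
          else Finset.univ).card = if l ∈ Finset.univ.image k then 1 else Fintype.card A + 1 := by
    intro l
    by_cases hl : l ∈ Finset.univ.image k
    · rw [if_pos hl, if_pos hl, hone l hl]
    · rw [if_neg hl, if_neg hl, Finset.card_univ, Fintype.card_option]
  simp_rw [this]
  rw [Finset.prod_ite, Finset.prod_const_one, one_mul, Finset.prod_const, ← pow_add]
  rw [Fintype.card_fun, Fintype.card_option]
  congr 1
  have h1 := Finset.card_filter_add_card_filter_not (s := (Finset.univ : Finset κ))
    (fun l => l ∈ Finset.univ.image k)
  rw [Finset.card_univ] at h1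
  have h2 : Finset.univ.filter (fun l => l ∈ Finset.univ.image k) = Finset.univ.image k := by
    ext; simp
  rw [h2] at h1
  omega

open Classical in
/-- The weight of the pattern `g` in the decoupling identity. -/
noncomputable def patternWeight (κ : Type) [Fintype κ] [DecidableEq κ] (g : A → A) : ℝ :=
  if ∃ k : A → κ, levelRep k = g then
    ((Fintype.card A : ℝ) + 1) ^ (Finset.univ.image g).card / Fintype.card (κ → Option A) else 0

theorem patternWeight_nonneg (g : A → A) : 0 ≤ patternWeight κ g := by
  unfold patternWeight; split_ifs <;> positivity

theorem patternWeight_mul_card_le (g : A → A) :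
    patternWeight κ g * Fintype.card (κ → Option A)
      ≤ ((Fintype.card A : ℝ) + 1) ^ Fintype.card A := by
  unfold patternWeight
  have h0 : (0 : ℝ) < Fintype.card (κ → Option A) := by exact_mod_cast Fintype.card_pos
  split_ifs
  · rw [div_mul_cancel₀ _ h0.ne']
    refine pow_le_pow_right₀ (by simp) ?_
    exact Finset.card_le_univ _
  · rw [zero_mul]; positivity

/-- Only the pattern of k itself contributes, and its weight is the inverse of the number of
colourings that k follows. -/
theorem sum_patternWeight_mul_card (k : A → κ) :
    ∑ g : A → A, patternWeight κ g * ∑ f : κ → Option A, (if Follows g f k then (1 : ℝ) else 0)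
      = 1 := by
  have h0 : (0 : ℝ) < Fintype.card (κ → Option A) := by exact_mod_cast Fintype.card_pos
  rw [Finset.sum_eq_single (levelRep k)]
  · have h := card_colorings k
    have h' : ((Finset.univ.filter fun f : κ → Option A => Follows (levelRep k) f k).card : ℝ)
      * (Fintype.card A + 1) ^ (Finset.univ.image (levelRep k)).card
      = Fintype.card (κ → Option A) := by exact_mod_cast h
    rw [Finset.sum_boole, patternWeight, if_pos ⟨k, rfl⟩, div_mul_eq_mul_div, mul_comm, h',
      div_self h0.ne']
  · intro g _ hg
    by_cases hex : ∃ k' : A → κ, levelRep k' = g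
    · obtain ⟨k', rfl⟩ := hex
      rw [Finset.sum_eq_zero, mul_zero]
      intro f _
      rw [if_neg fun h => hg h.levelRep_eq.symm]
    · rw [patternWeight, if_neg hex, zero_mul]
  · simp

/-- The bound is independent of κ, so decoupling costs a constant depending on r alone. -/
theorem sum_patternWeight_le :
    ∑ x : (A → A) × (κ → Option A), patternWeight κ x.1
      ≤ (Fintype.card A : ℝ) ^ Fintype.card A * ((Fintype.card A : ℝ) + 1) ^ Fintype.card A := by
  rw [Fintype.sum_prod_type]
  calc _ = ∑ g : A → A, patternWeight κ g * Fintype.card (κ → Option A) := by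
        refine Finset.sum_congr rfl fun g _ => ?_
        simp only [Finset.sum_const, Finset.card_univ, nsmul_eq_mul, mul_comm]
    _ ≤ ∑ g : A → A, ((Fintype.card A : ℝ) + 1) ^ Fintype.card A :=
        Finset.sum_le_sum fun g _ => patternWeight_mul_card_le g
    _ = _ := by
        rw [Finset.sum_const, Finset.card_univ, nsmul_eq_mul, Fintype.card_fun]
        push_cast; ring

/-- The polynomial `∑_k T_k ∏_j u_{k_j}^{ζ_j}` with matrix coefficients. -/
noncomputable def signPoly (ζ : A → ℤˣ) (T : (A → κ) → Matrix I J ℂ) (u : κ → ℂ) : Matrix I J ℂ :=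
  ∑ k, (∏ j, signPow (u (k j)) (ζ j)) • T k

theorem signPoly_eq_sum_restrictPattern (ζ : A → ℤˣ) (T : (A → κ) → Matrix I J ℂ) (u : κ → ℂ) :
    signPoly ζ T u = ∑ g : A → A, ∑ f : κ → Option A,
      patternWeight κ g • signPoly ζ (restrictPattern g f T) u := by
  have h1 : ∀ (g : A → A) (f : κ → Option A),
      patternWeight κ g • signPoly ζ (restrictPattern g f T) u
      = ∑ k, (patternWeight κ g * if Follows g f k then (1 : ℝ) else 0) •
        ((∏ j, signPow (u (k j)) (ζ j)) • T k) := by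
    intro g f
    rw [signPoly, Finset.smul_sum]
    refine Finset.sum_congr rfl fun k _ => ?_
    by_cases h : Follows g f k <;> simp [restrictPattern, h]
  simp_rw [h1]
  have h2 : ∀ g : A → A, ∑ f : κ → Option A, ∑ k,
      (patternWeight κ g * if Follows g f k then (1 : ℝ) else 0) •
        ((∏ j, signPow (u (k j)) (ζ j)) • T k)
      = ∑ k, (patternWeight κ g * ∑ f : κ → Option A, if Follows g f k then (1 : ℝ) else 0) •
        ((∏ j, signPow (u (k j)) (ζ j)) • T k) := by
    intro g
    rw [Finset.sum_comm]
    refine Finset.sum_congr rfl fun k _ => ?_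
    rw [← Finset.sum_smul, Finset.mul_sum]
  simp_rw [h2]
  rw [Finset.sum_comm]
  simp_rw [← Finset.sum_smul, sum_patternWeight_mul_card, one_smul]
  rfl

variable [Fintype I] [DecidableEq I] [Fintype J] [DecidableEq J]

omit [Fintype κ] [DecidableEq κ] in
-- Jensen's inequality for the normalized weights; if the total weight is 0, both sides vanish.
theorem sum_mul_pow_succ_le {ι : Type*} (s : Finset ι) {w z : ι → ℝ} (hw : ∀ i, 0 ≤ w i)
    (hz : ∀ i, 0 ≤ z i) (q : ℕ) :
    (∑ i ∈ s, w i * z i) ^ (q + 1) ≤ (∑ i ∈ s, w i) ^ q * ∑ i ∈ s, w i * z i ^ (q + 1) := by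
  set S := ∑ i ∈ s, w i
  have hS : 0 ≤ S := Finset.sum_nonneg fun i _ => hw i
  rcases hS.eq_or_lt with h0 | hpos
  · have h1 : ∀ i ∈ s, w i = 0 := (Finset.sum_eq_zero_iff_of_nonneg fun i _ => hw i).mp h0.symm
    rw [Finset.sum_eq_zero fun i hi => by rw [h1 i hi, zero_mul],
      Finset.sum_eq_zero fun i hi => by rw [h1 i hi, zero_mul]]
    simp
  · have h := Real.pow_arith_mean_le_arith_mean_pow s (fun i => w i / S) z
      (fun i _ => div_nonneg (hw i) hS) (by rw [← Finset.sum_div, div_self hpos.ne'])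
      (fun i _ => hz i) (q + 1)
    simp only [div_mul_eq_mul_div] at h
    rw [← Finset.sum_div, ← Finset.sum_div, div_pow, div_le_div_iff₀ (by positivity) hpos] at h
    refine le_of_mul_le_mul_right (h.trans (le_of_eq ?_)) hpos
    ring

/-- Decoupling in `L^q`: convexity of the norm along the decoupling identity. -/
theorem opNorm_signPoly_pow_le (ζ : A → ℤˣ) (T : (A → κ) → Matrix I J ℂ) (u : κ → ℂ) (q : ℕ) :
    ‖signPoly ζ T u‖ ^ (q + 1) ≤ (∑ x : (A → A) × (κ → Option A), patternWeight κ x.1) ^ q * ∑ x : (A → A) × (κ → Option A),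
      patternWeight κ x.1 * ‖signPoly ζ (restrictPattern x.1 x.2 T) u‖ ^ (q + 1) := by
  have h1 : ‖signPoly ζ T u‖ ≤ ∑ x : (A → A) × (κ → Option A),
      patternWeight κ x.1 * ‖signPoly ζ (restrictPattern x.1 x.2 T) u‖ := by
    rw [signPoly_eq_sum_restrictPattern, Fintype.sum_prod_type]
    refine (norm_sum_le _ _).trans (Finset.sum_le_sum fun g _ => (norm_sum_le _ _).trans
      (Finset.sum_le_sum fun f _ => ?_))
    rw [← Complex.coe_smul, norm_smul, Complex.norm_real, Real.norm_of_nonneg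
      (patternWeight_nonneg g)]
  refine (pow_le_pow_left₀ (norm_nonneg _) h1 _).trans ?_
  exact sum_mul_pow_succ_le Finset.univ
    (w := fun x : (A → A) × (κ → Option A) => patternWeight κ x.1)
    (z := fun x => ‖signPoly ζ (restrictPattern x.1 x.2 T) u‖)
    (fun x => patternWeight_nonneg x.1) (fun x => norm_nonneg _) q

end Decoupling

/-! ### Random signs from rotations of the variables -/

section Rotation

theorem signPow_mul (u v : ℂ) (ζ : ℤˣ) : signPow (u * v) ζ = signPow u ζ * signPow v ζ := by
  unfold signPow; split_ifs <;> simp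

theorem signPow_pow (u : ℂ) (ζ : ℤˣ) (n : ℕ) : signPow u ζ ^ n = signPow (u ^ n) ζ := by
  unfold signPow; split_ifs <;> simp

theorem norm_signPow (u : ℂ) (ζ : ℤˣ) : ‖signPow u ζ‖ = ‖u‖ := by
  unfold signPow; split_ifs <;> simp

theorem signPow_intCast (z : ℤ) (ζ : ℤˣ) : signPow (z : ℂ) ζ = z := by
  unfold signPow; split_ifs <;> simp

theorem measurable_signPow (ζ : ℤˣ) : Measurable fun u => signPow u ζ := by
  unfold signPow; split_ifs
  · exact measurable_id
  · exact Complex.continuous_conj.measurable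

variable {A : Type*} {κ I J : Type} [Fintype A] [DecidableEq A]
variable [Fintype κ] [DecidableEq κ]

/-- An `n`-th root of the sign `σ`. -/
noncomputable def signRoot (n : ℕ) (σ : ℤˣ) : ℂ :=
  if σ = 1 then 1 else Complex.exp ((Real.pi / n : ℝ) * Complex.I)

theorem norm_signRoot (n : ℕ) (σ : ℤˣ) : ‖signRoot n σ‖ = 1 := by
  unfold signRoot; split_ifs
  · simp
  · exact Complex.norm_exp_ofReal_mul_I _

theorem signRoot_pow {n : ℕ} (hn : n ≠ 0) (σ : ℤˣ) : signRoot n σ ^ n = ((σ : ℤ) : ℂ) := by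
  unfold signRoot
  rcases Int.units_eq_one_or σ with h | h
  · simp [h]
  · have hn' : (n : ℂ) ≠ 0 := by exact_mod_cast hn
    rw [if_neg (by rw [h]; decide), ← Complex.exp_nat_mul, h]
    have : (n : ℂ) * (((Real.pi / n : ℝ) : ℂ) * Complex.I) = Real.pi * Complex.I := by
      push_cast; field_simp
    rw [this, Complex.exp_pi_mul_I]; simp

/-- The rotations of the variables `u_l` which produce the signs `ε` in the part of a tensor
following the pattern `g` and the colouring `f`. -/
noncomputable def patternRotation (g : A → A) (f : κ → Option A) (ε : A → κ → ℤˣ) (l : κ) : ℂ :=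
  match f l with
  | none => 1
  | some a => signRoot (Finset.univ.filter fun j => g j = a).card (∏ j with g j = a, ε j l)

omit [Fintype κ] [DecidableEq κ] in
theorem norm_patternRotation (g : A → A) (f : κ → Option A) (ε : A → κ → ℤˣ) (l : κ) :
    ‖patternRotation g f ε l‖ = 1 := by
  unfold patternRotation
  split
  · simp
  · exact norm_signRoot _ _

omit [Fintype κ] [DecidableEq κ] in
-- Within a class of n slots the vectors coincide, so the signs ζ agree and the product is the n-th
-- power of one rotation, or its conjugate. That power is the real number ∏ ε_j, which conjugation
-- fixes.
theorem prod_signPow_patternRotation {g : A → A} {f : κ → Option A} {k : A → κ}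
    (hk : Follows g f k) {ζ : A → ℤˣ} (hζ : ∀ i j, k i = k j → ζ i = ζ j) (ε : A → κ → ℤˣ) :
    ∏ j, signPow (patternRotation g f ε (k j)) (ζ j) = ∏ j, ((ε j (k j) : ℤ) : ℂ) := by
  rw [← Finset.prod_fiberwise Finset.univ g fun j => signPow (patternRotation g f ε (k j)) (ζ j),
    ← Finset.prod_fiberwise Finset.univ g fun j => ((ε j (k j) : ℤ) : ℂ)]
  refine Finset.prod_congr rfl fun a _ => ?_
  rcases (Finset.univ.filter fun j => g j = a).eq_empty_or_nonempty with he | ⟨j₀, hj₀⟩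
  · rw [he]; simp
  have hk0 : ∀ j ∈ Finset.univ.filter (fun j => g j = a), k j = k a := fun j hj => by
    rw [← hk.2 j, (Finset.mem_filter.mp hj).2]
  have hf : f (k a) = some a := by
    rw [← hk0 j₀ hj₀, hk.1, (Finset.mem_filter.mp hj₀).2]
  have h1 : ∀ j ∈ Finset.univ.filter (fun j => g j = a),
      signPow (patternRotation g f ε (k j)) (ζ j)
        = signPow (patternRotation g f ε (k a)) (ζ j₀) := fun j hj => by
    rw [hk0 j hj, hζ j j₀ (by rw [hk0 j hj, hk0 j₀ hj₀])]
  rw [Finset.prod_congr rfl h1, Finset.prod_const, signPow_pow]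
  have h2 : patternRotation g f ε (k a) ^ (Finset.univ.filter fun j => g j = a).card
      = (((∏ j with g j = a, ε j (k a) : ℤˣ) : ℤ) : ℂ) := by
    unfold patternRotation
    rw [hf]
    exact signRoot_pow (Finset.card_ne_zero_of_mem hj₀) _
  rw [h2, signPow_intCast, Units.coe_prod, Int.cast_prod]
  exact Finset.prod_congr rfl fun j hj => by rw [hk0 j hj]

theorem signPoly_patternRotation_mul (g : A → A) (f : κ → Option A) (ζ : A → ℤˣ)
    {T : (A → κ) → Matrix I J ℂ} (hT : ∀ k, T k ≠ 0 → ∀ i j, k i = k j → ζ i = ζ j)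
    (ε : A → κ → ℤˣ) (u : κ → ℂ) :
    signPoly ζ (restrictPattern g f T) (fun l => patternRotation g f ε l * u l)
      = chaos (fun k => (∏ j, signPow (u (k j)) (ζ j)) • restrictPattern g f T k) ε := by
  unfold signPoly chaos
  refine Finset.sum_congr rfl fun k _ => ?_
  by_cases hk : Follows g f k
  · by_cases hT0 : T k = 0
    · simp [restrictPattern, hT0]
    · rw [smul_smul, ← prod_signPow_patternRotation hk (hT k hT0) ε, ← Finset.prod_mul_distrib]
      simp_rw [signPow_mul]
  · simp [restrictPattern, hk]

variable [Fintype I] [DecidableEq I] [Fintype J] [DecidableEq J]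

theorem sum_opNorm_signPoly_patternRotation_pow_le (g : A → A) (f : κ → Option A) (ζ : A → ℤˣ)
    {T : (A → κ) → Matrix I J ℂ} (hT : ∀ k, T k ≠ 0 → ∀ i j, k i = k j → ζ i = ζ j)
    {u : κ → ℂ} (hu : ∀ l, ‖u l‖ ≤ 1) {p : ℕ} (hp : p ≠ 0) {R D : ℝ}
    (hD : (Fintype.card I + Fintype.card J : ℝ) * (Fintype.card κ + 1) ^ Fintype.card A ≤ D)
    (hR : ∀ B, ‖flatten T B‖ ≤ R) :
    ∑ ε : A → κ → ℤˣ, ‖signPoly ζ (restrictPattern g f T)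
        (fun l => patternRotation g f ε l * u l)‖ ^ (2 * p)
      ≤ (2 * D * (4 * p) ^ p) ^ Fintype.card A * R ^ (2 * p) * Fintype.card (A → κ → ℤˣ) := by
  simp_rw [signPoly_patternRotation_mul g f ζ hT]
  refine sum_opNorm_chaos_pow_le hp _ hD fun B => ?_
  refine (opNorm_flatten_prod_smul_le (restrictPattern g f T)
    (c := fun j l => signPow (u l) (ζ j)) (fun j l => ?_) B).trans
      ((opNorm_flatten_restrictPattern_le g f T B).trans (hR B))
  rw [norm_signPow]; exact hu l

end Rotation

/-! ### Rotation invariance of the uniform law on the circle -/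

section Law

theorem continuous_coe_toCircle : Continuous fun x : UnitAddCircle => (AddCircle.toCircle x : ℂ) :=
  continuous_subtype_val.comp AddCircle.continuous_toCircle

/-- As the image of Haar measure on ℝ/ℤ, the law inherits rotation invariance from translation
invariance. -/
theorem unitCircleLaw_eq_map_toCircle :
    unitCircleLaw = (volume : Measure UnitAddCircle).map fun x => (AddCircle.toCircle x : ℂ) := by
  have h := (UnitAddCircle.measurePreserving_mk 0).map_eq
  have hm : Measurable fun x : UnitAddCircle => (AddCircle.toCircle x : ℂ) :=
    continuous_coe_toCircle.measurable
  rw [← h, Measure.map_map hm (UnitAddCircle.measurePreserving_mk 0).measurable, unitCircleLaw,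
    Measure.restrict_congr_set Ico_ae_eq_Ioc, zero_add]
  congr 1
  funext t
  simp [AddCircle.toCircle_apply_mk, Circle.coe_exp]

theorem unitCircleLaw_map_mul {ρ : ℂ} (hρ : ‖ρ‖ = 1) :
    unitCircleLaw.map (fun z => ρ * z) = unitCircleLaw := by
  obtain ⟨x₀, hx₀⟩ : ∃ x₀ : UnitAddCircle, (AddCircle.toCircle x₀ : ℂ) = ρ := by
    refine ⟨((Complex.arg ρ / (2 * Real.pi) : ℝ) : UnitAddCircle), ?_⟩
    rw [AddCircle.toCircle_apply_mk, Circle.coe_exp, div_one, mul_div_cancel₀ _ (by positivity)]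
    simpa [hρ] using Complex.norm_mul_exp_arg_mul_I ρ
  have hm : Measurable fun x : UnitAddCircle => (AddCircle.toCircle x : ℂ) :=
    continuous_coe_toCircle.measurable
  have hinv : (volume : Measure UnitAddCircle).map (fun x => x₀ + x) = volume :=
    map_add_left_eq_self _ x₀
  rw [unitCircleLaw_eq_map_toCircle, Measure.map_map (measurable_const_mul ρ) hm]
  conv_rhs => rw [← hinv, Measure.map_map hm (measurable_const_add x₀)]
  congr 1
  funext x
  simp [AddCircle.toCircle_add, hx₀]

theorem ae_unitCircleLaw_norm_eq_one : ∀ᵐ z ∂unitCircleLaw, ‖z‖ = 1 := by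
  rw [unitCircleLaw_eq_map_toCircle, ae_map_iff]
  · exact Filter.Eventually.of_forall fun x => Circle.norm_coe _
  · exact continuous_coe_toCircle.measurable.aemeasurable
  · exact (isClosed_eq continuous_norm continuous_const).measurableSet

variable {Ω : Type*} [MeasurableSpace Ω] {P : Measure Ω} {κ : Type*} [Fintype κ]
  {η : κ → Ω → ℂ}

theorem ae_norm_le_one (hm : ∀ k, Measurable (η k)) (hlaw : ∀ k, P.map (η k) = unitCircleLaw) :
    ∀ᵐ ω ∂P, ∀ k, ‖η k ω‖ ≤ 1 := by
  rw [ae_all_iff]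
  intro k
  have h := ae_unitCircleLaw_norm_eq_one
  rw [← hlaw k] at h
  filter_upwards [ae_of_ae_map (hm k).aemeasurable h] with ω hω using hω.le

/-- By independence the joint law of (X, η) is a product, and each circle factor is invariant under
its own rotation. -/
theorem lintegral_rotate [IsProbabilityMeasure P] {𝓧 : Type*} [MeasurableSpace 𝓧] {X : Ω → 𝓧}
    (hX : Measurable X) (hm : ∀ k, Measurable (η k)) (hlaw : ∀ k, P.map (η k) = unitCircleLaw)
    (hind : iIndepFun η P) (hXη : IndepFun X (fun ω k => η k ω) P)
    {F : 𝓧 × (κ → ℂ) → ℝ≥0∞} (hF : Measurable F) {ρ : κ → ℂ} (hρ : ∀ k, ‖ρ k‖ = 1) :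
    ∫⁻ ω, F (X ω, fun k => ρ k * η k ω) ∂P = ∫⁻ ω, F (X ω, fun k => η k ω) ∂P := by
  have hηm : Measurable fun ω k => η k ω := measurable_pi_lambda _ hm
  have hmul : Measurable fun (u : κ → ℂ) k => ρ k * u k :=
    measurable_pi_lambda _ fun k => (measurable_const_mul (ρ k)).comp (measurable_pi_apply k)
  have hm' : ∀ k, Measurable fun ω => ρ k * η k ω := fun k => (hm k).const_mul _
  have hηm' : Measurable fun ω k => ρ k * η k ω := measurable_pi_lambda _ hm'
  have h1 := (indepFun_iff_map_prod_eq_prod_map_map hX.aemeasurable hηm.aemeasurable).mp hXη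
  have h2 := (indepFun_iff_map_prod_eq_prod_map_map hX.aemeasurable hηm'.aemeasurable).mp
    (hXη.comp measurable_id hmul)
  have h3 := (iIndepFun_iff_map_fun_eq_pi_map fun k => (hm k).aemeasurable).mp hind
  have h4 := (iIndepFun_iff_map_fun_eq_pi_map fun k => (hm' k).aemeasurable).mp
    (hind.comp (fun k z => ρ k * z) fun k => measurable_const_mul _)
  have h5 : ∀ k, P.map (fun ω => ρ k * η k ω) = P.map (η k) := by
    intro k
    rw [hlaw k, ← unitCircleLaw_map_mul (hρ k), ← hlaw k,
      Measure.map_map (measurable_const_mul _) (hm k)]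
    rfl
  simp_rw [h5] at h4
  rw [← lintegral_map (g := fun ω => (X ω, fun k => ρ k * η k ω)) hF (hX.prodMk hηm'),
    ← lintegral_map (g := fun ω => (X ω, fun k => η k ω)) hF (hX.prodMk hηm), h2, h1, h3, h4]

end Law

/-! ### Moments and tails of random matrix polynomials -/

section Moments

variable {A : Type*} {κ I J : Type} [Fintype A] [DecidableEq A]
variable [Fintype κ] [DecidableEq κ]

/-- The family of matrices with entries `x k i j`. -/
def toMatrices (x : (A → κ) → I → J → ℂ) : (A → κ) → Matrix I J ℂ := fun k => Matrix.of (x k)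

variable [Fintype I] [DecidableEq I] [Fintype J] [DecidableEq J]

/-- The maximum of the norms of all flattenings of a tensor. -/
noncomputable def maxFlattenNorm (T : (A → κ) → Matrix I J ℂ) : ℝ := ‖fun B => ‖flatten T B‖‖

theorem maxFlattenNorm_nonneg (T : (A → κ) → Matrix I J ℂ) : 0 ≤ maxFlattenNorm T := norm_nonneg _

theorem opNorm_flatten_le_maxFlattenNorm (T : (A → κ) → Matrix I J ℂ) (B : A → Bool) :
    ‖flatten T B‖ ≤ maxFlattenNorm T := by
  refine le_trans (le_of_eq (norm_norm _).symm) (norm_le_pi_norm (fun B => ‖flatten T B‖) B)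

theorem exists_maxFlattenNorm_eq (T : (A → κ) → Matrix I J ℂ) :
    ∃ B, maxFlattenNorm T = ‖flatten T B‖ := by
  obtain ⟨B, -, hB⟩ := Finset.exists_max_image Finset.univ (fun B : A → Bool => ‖flatten T B‖)
    Finset.univ_nonempty
  refine ⟨B, le_antisymm ?_ (opNorm_flatten_le_maxFlattenNorm T B)⟩
  refine (pi_norm_le_iff_of_nonneg (norm_nonneg _)).mpr fun B' => ?_
  rw [norm_norm]
  exact hB B' (Finset.mem_univ _)

theorem norm_entry_le_maxFlattenNorm (T : (A → κ) → Matrix I J ℂ) (k : A → κ) (i : I) (j : J) :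
    ‖T k i j‖ ≤ maxFlattenNorm T := by
  refine le_trans ?_ (opNorm_flatten_le_maxFlattenNorm T fun _ => true)
  refine le_trans (le_of_eq ?_) (norm_entry_le_opNorm (flatten T fun _ => true)
    (i, fun j => k j.1) (j, fun j => k j.1))
  have : join (fun _ => true) (fun j => k j.1) (fun j => k j.1) = k := by funext a; simp [join]
  simp only [flatten, Matrix.of_apply, this]

/-- Covers the points where the normalized ratio has denominator 0 and is 0 by convention: the tail
event cannot occur there. -/
theorem signPoly_eq_zero_of_maxFlattenNorm (ζ : A → ℤˣ) {T : (A → κ) → Matrix I J ℂ} (u : κ → ℂ)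
    (h : maxFlattenNorm T = 0) : signPoly ζ T u = 0 := by
  unfold signPoly
  refine Finset.sum_eq_zero fun k _ => ?_
  have : T k = 0 := by
    ext i j
    have := norm_entry_le_maxFlattenNorm T k i j
    rw [h] at this
    simpa using this
  rw [this, smul_zero]

theorem measurable_maxFlattenNorm :
    Measurable fun x : (A → κ) → I → J → ℂ => maxFlattenNorm (toMatrices x) := by
  unfold maxFlattenNorm
  refine measurable_norm.comp (measurable_pi_lambda _ fun B => measurable_opNorm fun i j => ?_)
  exact (measurable_pi_apply j.1).comp ((measurable_pi_apply i.1).comp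
    (measurable_pi_apply (join B i.2 j.2)))

theorem measurable_opNorm_signPoly {𝓨 : Type*} [MeasurableSpace 𝓨] (ζ : A → ℤˣ)
    {T : 𝓨 → (A → κ) → Matrix I J ℂ} {u : 𝓨 → κ → ℂ}
    (hT : ∀ k i j, Measurable fun y => T y k i j) (hu : ∀ k, Measurable fun y => u y k) :
    Measurable fun y => ‖signPoly ζ (T y) (u y)‖ := by
  refine measurable_opNorm fun i j => ?_
  simp only [signPoly, Matrix.sum_apply, Matrix.smul_apply, smul_eq_mul]
  refine Finset.measurable_sum _ fun k _ => Measurable.mul ?_ (hT k i j)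
  exact Finset.measurable_prod _ fun a _ => (measurable_signPow (ζ a)).comp (hu (k a))

theorem measurable_opNorm_signPoly_restrictPattern (g : A → A) (f : κ → Option A) (ζ : A → ℤˣ) :
    Measurable fun x : ((A → κ) → I → J → ℂ) × (κ → ℂ) =>
      ‖signPoly ζ (restrictPattern g f (toMatrices x.1)) x.2‖ := by
  refine measurable_opNorm_signPoly ζ (fun k i j => ?_)
    fun k => (measurable_pi_apply k).comp measurable_snd
  unfold restrictPattern
  split_ifs
  · exact (measurable_pi_apply j).comp ((measurable_pi_apply i).comp
      ((measurable_pi_apply k).comp measurable_fst))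
  · exact measurable_const

variable {Ω : Type*} [MeasurableSpace Ω] {P : Measure Ω} [IsProbabilityMeasure P]
  {X : Ω → (A → κ) → I → J → ℂ} {η : κ → Ω → ℂ} {ζ : A → ℤˣ}

/-- The integral is the same for every rotation, so it equals its average over all sign arrays ε.
Under the integral that average is a Rademacher chaos moment, bounded for almost every ω. -/
theorem lintegral_opNorm_restrictPattern_le (hX : Measurable X) (hm : ∀ k, Measurable (η k))
    (hlaw : ∀ k, P.map (η k) = unitCircleLaw) (hind : iIndepFun η P)
    (hXη : IndepFun X (fun ω k => η k ω) P)
    (hζ : ∀ ω k, toMatrices (X ω) k ≠ 0 → ∀ i j, k i = k j → ζ i = ζ j)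
    (g : A → A) (f : κ → Option A) {p : ℕ} (hp : p ≠ 0) {D : ℝ}
    (hD : (Fintype.card I + Fintype.card J : ℝ) * (Fintype.card κ + 1) ^ Fintype.card A ≤ D) :
    ∫⁻ ω, ENNReal.ofReal ((‖signPoly ζ (restrictPattern g f (toMatrices (X ω))) fun k => η k ω‖
        / maxFlattenNorm (toMatrices (X ω))) ^ (2 * p)) ∂P
      ≤ ENNReal.ofReal ((2 * D * (4 * p) ^ p) ^ Fintype.card A) := by
  set F : ((A → κ) → I → J → ℂ) × (κ → ℂ) → ℝ≥0∞ := fun x =>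
    ENNReal.ofReal ((‖signPoly ζ (restrictPattern g f (toMatrices x.1)) x.2‖
      / maxFlattenNorm (toMatrices x.1)) ^ (2 * p)) with hFdef
  have hF : Measurable F := (((measurable_opNorm_signPoly_restrictPattern g f ζ).div
    (measurable_maxFlattenNorm.comp measurable_fst)).pow_const _).ennreal_ofReal
  set N : ℕ := Fintype.card (A → κ → ℤˣ)
  set c : ℝ := (2 * D * (4 * p) ^ p) ^ Fintype.card A
  have hrot : ∀ ε : A → κ → ℤˣ, ∫⁻ ω, F (X ω, fun k => patternRotation g f ε k * η k ω) ∂P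
      = ∫⁻ ω, F (X ω, fun k => η k ω) ∂P := fun ε =>
    lintegral_rotate hX hm hlaw hind hXη hF (norm_patternRotation g f ε)
  have hXu : ∀ ε : A → κ → ℤˣ,
      Measurable fun ω => F (X ω, fun k => patternRotation g f ε k * η k ω) := fun ε =>
    hF.comp (hX.prodMk (measurable_pi_lambda _ fun k => (hm k).const_mul _))
  have hpt : ∀ᵐ ω ∂P, ∑ ε : A → κ → ℤˣ, F (X ω, fun k => patternRotation g f ε k * η k ω)
      ≤ ENNReal.ofReal (c * N) := by
    filter_upwards [ae_norm_le_one hm hlaw] with ω hω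
    simp only [hFdef]
    rw [← ENNReal.ofReal_sum_of_nonneg fun ε _ => Even.pow_nonneg (even_two_mul p) _]
    refine ENNReal.ofReal_le_ofReal ?_
    simp_rw [div_pow]
    rw [← Finset.sum_div]
    have h := sum_opNorm_signPoly_patternRotation_pow_le g f ζ (hζ ω) hω hp hD
      (opNorm_flatten_le_maxFlattenNorm (toMatrices (X ω)))
    refine div_le_of_le_mul₀ (by rw [pow_mul]; positivity) ?_ (h.trans (le_of_eq (by ring)))
    have hD0 : 0 ≤ D := le_trans (by positivity) hD
    positivity
  have h1 : (N : ℝ≥0∞) * ∫⁻ ω, F (X ω, fun k => η k ω) ∂P ≤ N * ENNReal.ofReal c := by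
    calc (N : ℝ≥0∞) * ∫⁻ ω, F (X ω, fun k => η k ω) ∂P
        = ∑ ε : A → κ → ℤˣ, ∫⁻ ω, F (X ω, fun k => patternRotation g f ε k * η k ω) ∂P := by
          simp_rw [hrot]
          rw [Finset.sum_const, Finset.card_univ, nsmul_eq_mul]
      _ = ∫⁻ ω, ∑ ε : A → κ → ℤˣ, F (X ω, fun k => patternRotation g f ε k * η k ω) ∂P :=
          (lintegral_finsetSum _ fun ε _ => hXu ε).symm
      _ ≤ ∫⁻ _, ENNReal.ofReal (c * N) ∂P := lintegral_mono_ae hpt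
      _ = N * ENNReal.ofReal c := by
          rw [lintegral_const, measure_univ, mul_one, mul_comm c,
            ENNReal.ofReal_mul (by positivity), ENNReal.ofReal_natCast]
  have hN0 : (N : ℝ≥0∞) ≠ 0 := by exact_mod_cast (Fintype.card_pos (α := A → κ → ℤˣ)).ne'
  exact (ENNReal.mul_le_mul_iff_right hN0 (ENNReal.natCast_ne_top N)).mp h1

theorem lintegral_opNorm_signPoly_le (hX : Measurable X) (hm : ∀ k, Measurable (η k))
    (hlaw : ∀ k, P.map (η k) = unitCircleLaw) (hind : iIndepFun η P)
    (hXη : IndepFun X (fun ω k => η k ω) P)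
    (hζ : ∀ ω k, toMatrices (X ω) k ≠ 0 → ∀ i j, k i = k j → ζ i = ζ j)
    {p : ℕ} (hp : p ≠ 0) {D W : ℝ}
    (hD : (Fintype.card I + Fintype.card J : ℝ) * (Fintype.card κ + 1) ^ Fintype.card A ≤ D)
    (hW : (Fintype.card A : ℝ) ^ Fintype.card A
      * ((Fintype.card A : ℝ) + 1) ^ Fintype.card A ≤ W) :
    ∫⁻ ω, ENNReal.ofReal ((‖signPoly ζ (toMatrices (X ω)) fun k => η k ω‖
        / maxFlattenNorm (toMatrices (X ω))) ^ (2 * p)) ∂P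
      ≤ ENNReal.ofReal (W ^ (2 * p) * (2 * D * (4 * p) ^ p) ^ Fintype.card A) := by
  set c : ℝ := (2 * D * (4 * p) ^ p) ^ Fintype.card A
  have hD0 : 0 ≤ D := le_trans (by positivity) hD
  have hc : 0 ≤ c := by positivity
  set S : ℝ := ∑ x : (A → A) × (κ → Option A), patternWeight κ x.1
  have hS0 : 0 ≤ S := Finset.sum_nonneg fun x _ => patternWeight_nonneg x.1
  have hSW : S ≤ W := sum_patternWeight_le.trans hW
  obtain ⟨q, hq⟩ : ∃ q, 2 * p = q + 1 := ⟨2 * p - 1, by omega⟩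
  have hmeas : ∀ x : (A → A) × (κ → Option A), Measurable fun ω => ENNReal.ofReal
      ((‖signPoly ζ (restrictPattern x.1 x.2 (toMatrices (X ω))) fun k => η k ω‖
        / maxFlattenNorm (toMatrices (X ω))) ^ (2 * p)) := fun x =>
    ((((measurable_opNorm_signPoly_restrictPattern x.1 x.2 ζ).comp
      (hX.prodMk (measurable_pi_lambda _ hm))).div
      (measurable_maxFlattenNorm.comp hX)).pow_const _).ennreal_ofReal
  calc _ ≤ ∫⁻ ω, ENNReal.ofReal (S ^ q) * ∑ x : (A → A) × (κ → Option A),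
        ENNReal.ofReal (patternWeight κ x.1) * ENNReal.ofReal
        ((‖signPoly ζ (restrictPattern x.1 x.2 (toMatrices (X ω))) fun k => η k ω‖
          / maxFlattenNorm (toMatrices (X ω))) ^ (2 * p)) ∂P := by
        refine lintegral_mono fun ω => ?_
        simp_rw [← ENNReal.ofReal_mul (patternWeight_nonneg _)]
        rw [← ENNReal.ofReal_sum_of_nonneg fun x _ => mul_nonneg (patternWeight_nonneg _)
          (Even.pow_nonneg (even_two_mul p) _), ← ENNReal.ofReal_mul (by positivity)]
        refine ENNReal.ofReal_le_ofReal ?_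
        simp_rw [div_pow, ← mul_div_assoc]
        rw [← Finset.sum_div, ← mul_div_assoc]
        refine div_le_div_of_nonneg_right ?_ (pow_nonneg (maxFlattenNorm_nonneg _) _)
        rw [hq]
        exact opNorm_signPoly_pow_le ζ (toMatrices (X ω)) (fun k => η k ω) q
    _ = ENNReal.ofReal (S ^ q) * ∑ x : (A → A) × (κ → Option A),
        ENNReal.ofReal (patternWeight κ x.1) * ∫⁻ ω, ENNReal.ofReal
        ((‖signPoly ζ (restrictPattern x.1 x.2 (toMatrices (X ω))) fun k => η k ω‖
          / maxFlattenNorm (toMatrices (X ω))) ^ (2 * p)) ∂P := by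
        rw [lintegral_const_mul _ (Finset.measurable_sum _ fun x _ => (hmeas x).const_mul _),
          lintegral_finsetSum _ fun x _ => (hmeas x).const_mul _]
        congr 1
        exact Finset.sum_congr rfl fun x _ => lintegral_const_mul _ (hmeas x)
    _ ≤ ENNReal.ofReal (S ^ q) * ∑ x : (A → A) × (κ → Option A),
        ENNReal.ofReal (patternWeight κ x.1) * ENNReal.ofReal c := by
        gcongr with x
        exact lintegral_opNorm_restrictPattern_le hX hm hlaw hind hXη hζ x.1 x.2 hp hD
    _ = ENNReal.ofReal (S ^ q * (S * c)) := by
        rw [← Finset.sum_mul, ← ENNReal.ofReal_sum_of_nonneg fun x _ => patternWeight_nonneg _,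
          ← ENNReal.ofReal_mul hS0, ← ENNReal.ofReal_mul (by positivity)]
    _ ≤ _ := by
        refine ENNReal.ofReal_le_ofReal ?_
        rw [← mul_assoc, ← pow_succ, ← hq]
        gcongr

/-- Markov's inequality for the 2p-th moment of the ratio; the random norm of the tensor stays
inside the ratio. -/
theorem measure_lt_opNorm_signPoly_le (hX : Measurable X) (hm : ∀ k, Measurable (η k))
    (hlaw : ∀ k, P.map (η k) = unitCircleLaw) (hind : iIndepFun η P)
    (hXη : IndepFun X (fun ω k => η k ω) P)
    (hζ : ∀ ω k, toMatrices (X ω) k ≠ 0 → ∀ i j, k i = k j → ζ i = ζ j)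
    {p : ℕ} (hp : p ≠ 0) {D W : ℝ}
    (hD : (Fintype.card I + Fintype.card J : ℝ) * (Fintype.card κ + 1) ^ Fintype.card A ≤ D)
    (hW : (Fintype.card A : ℝ) ^ Fintype.card A
      * ((Fintype.card A : ℝ) + 1) ^ Fintype.card A ≤ W) {l : ℝ} (hl : 0 < l) :
    P {ω | l * maxFlattenNorm (toMatrices (X ω)) < ‖signPoly ζ (toMatrices (X ω)) fun k => η k ω‖}
      ≤ ENNReal.ofReal (W ^ (2 * p) * (2 * D * (4 * p) ^ p) ^ Fintype.card A / l ^ (2 * p)) := by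
  have h := lintegral_opNorm_signPoly_le hX hm hlaw hind hXη hζ hp hD hW
  set G : Ω → ℝ≥0∞ := fun ω => ENNReal.ofReal ((‖signPoly ζ (toMatrices (X ω)) fun k => η k ω‖
        / maxFlattenNorm (toMatrices (X ω))) ^ (2 * p))
  have hl' : 0 < l ^ (2 * p) := by positivity
  have hsub : {ω | l * maxFlattenNorm (toMatrices (X ω))
      < ‖signPoly ζ (toMatrices (X ω)) fun k => η k ω‖} ⊆ {ω | ENNReal.ofReal (l ^ (2 * p)) ≤ G ω} := by
    intro ω hω
    rw [Set.mem_ofPred_eq] at hω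
    have hR : 0 < maxFlattenNorm (toMatrices (X ω)) := by
      refine lt_of_le_of_ne (maxFlattenNorm_nonneg _) fun h0 => ?_
      rw [signPoly_eq_zero_of_maxFlattenNorm ζ _ h0.symm, norm_zero, ← h0, mul_zero] at hω
      exact lt_irrefl _ hω
    refine ENNReal.ofReal_le_ofReal (pow_le_pow_left₀ hl.le ?_ _)
    rw [le_div_iff₀ hR]
    exact hω.le
  refine (measure_mono hsub).trans ?_
  refine (meas_ge_le_lintegral_div ?_ (by simpa using hl') ENNReal.ofReal_ne_top).trans ?_
  · refine ((Measurable.div (measurable_opNorm_signPoly ζ (fun k i j => ?_) hm)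
      (measurable_maxFlattenNorm.comp hX)).pow_const _).ennreal_ofReal.aemeasurable
    exact (measurable_pi_apply j).comp ((measurable_pi_apply i).comp
      ((measurable_pi_apply k).comp hX))
  · rw [ENNReal.ofReal_div_of_pos hl']
    gcongr

end Moments

/-! ### Kernel norms and finite matrices -/

section Kernel

variable {α β X Y : Type*} [Fintype X] [DecidableEq X] [Fintype Y] [DecidableEq Y]

theorem ofReal_sq_rpow_half {x : ℝ} (hx : 0 ≤ x) :
    (ENNReal.ofReal (x ^ 2)) ^ (1 / 2 : ℝ) = ENNReal.ofReal x := by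
  rw [ENNReal.ofReal_pow hx, ← ENNReal.rpow_natCast, ← ENNReal.rpow_mul]
  norm_num

theorem enorm_sq_eq_ofReal (z : ℂ) : ‖z‖ₑ ^ 2 = ENNReal.ofReal (‖z‖ ^ 2) := by
  rw [ENNReal.ofReal_pow (norm_nonneg _), ofReal_norm]

theorem kernelNorm_le_opNorm {T : α → β → ℂ} {φ : X → α} {ψ : Y → β} (hφ : φ.Injective)
    (hψ : ψ.Injective) (hT : ∀ a b, T a b ≠ 0 → a ∈ Set.range φ ∧ b ∈ Set.range ψ) :
    kernelNorm T ≤ ENNReal.ofReal ‖Matrix.of fun y x => T (φ x) (ψ y)‖ := by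
  set M : Matrix Y X ℂ := Matrix.of fun y x => T (φ x) (ψ y)
  refine iSup₂_le fun z hz => ?_
  have h1 : ∀ b, ∑' a, T a b * z a = ∑ x, T (φ x) b * z (φ x) := by
    intro b
    rw [← hφ.tsum_eq, tsum_fintype]
    intro a ha
    exact (hT a b (left_ne_zero_of_mul ha)).1
  have h2 : ∑' b, ‖∑' a, T a b * z a‖ₑ ^ 2 = ENNReal.ofReal (∑ y, ‖(M *ᵥ (z ∘ φ)) y‖ ^ 2) := by
    rw [← hψ.tsum_eq, tsum_fintype, ENNReal.ofReal_sum_of_nonneg fun _ _ => by positivity]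
    · refine Finset.sum_congr rfl fun y _ => ?_
      rw [enorm_sq_eq_ofReal, h1]
      rfl
    · intro b hb
      by_contra hbr
      refine hb ?_
      have : ∀ a, T a b = 0 := fun a => by
        by_contra h; exact hbr (hT a b h).2
      simp [this]
  have h3 : ∑ x, ‖(z ∘ φ) x‖ ^ 2 ≤ 1 := by
    have := sum_le_hasSum (Finset.univ.map ⟨φ, hφ⟩) (fun _ _ => by positivity) hz
    simpa using this
  rw [h2, ← ofReal_sq_rpow_half (norm_nonneg M)]
  gcongr
  exact (sum_norm_sq_mulVec_le M _).trans (mul_le_of_le_one_right (by positivity) h3)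

/-- A nonzero vector on X, normalized and extended by zero, is a competitor in the supremum;
restricting the output to ψ only loses mass. -/
theorem opNorm_le_kernelNorm (T : α → β → ℂ) {φ : X → α} {ψ : Y → β} (hφ : φ.Injective)
    (hψ : ψ.Injective) :
    ENNReal.ofReal ‖Matrix.of fun y x => T (φ x) (ψ y)‖ ≤ kernelNorm T := by
  set M : Matrix Y X ℂ := Matrix.of fun y x => T (φ x) (ψ y)
  rcases eq_or_ne (kernelNorm T) ⊤ with htop | htop
  · rw [htop]; exact le_top
  refine ENNReal.ofReal_le_of_le_toReal (opNorm_le_of_sum_norm_sq_le ENNReal.toReal_nonneg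
    fun v => ?_)
  set s : ℝ := ∑ x, ‖v x‖ ^ 2
  have hs : 0 ≤ s := Finset.sum_nonneg fun _ _ => by positivity
  rcases hs.eq_or_lt with h0 | hpos
  · have hv : v = 0 := by
      funext x
      have := (Finset.sum_eq_zero_iff_of_nonneg fun x _ => by positivity).mp h0.symm x
        (Finset.mem_univ x)
      simpa using this
    simp [hv, ← h0]
  set t : ℝ := Real.sqrt s
  have ht : 0 < t := Real.sqrt_pos.mpr hpos
  have hts : t ^ 2 = s := Real.sq_sqrt hs
  let z : α → ℂ := Function.extend φ (fun x => v x / t) 0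
  have hzφ : ∀ x, z (φ x) = v x / t := fun x => hφ.extend_apply _ _ x
  have hz0 : ∀ a, a ∉ Set.range φ → z a = 0 := fun a ha => Function.extend_apply' _ _ _ (by simpa using ha)
  have hz : HasSum (fun a => ‖z a‖ ^ 2) 1 := by
    rw [← hφ.hasSum_iff fun a ha => by simp [hz0 a ha]]
    have : ∑ x, ((fun a => ‖z a‖ ^ 2) ∘ φ) x = 1 := by
      simp only [Function.comp, hzφ, norm_div, div_pow, Complex.norm_real, Real.norm_of_nonneg ht.le]
      rw [← Finset.sum_div, hts, div_self hpos.ne']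
    rw [← this]
    exact hasSum_fintype _
  have h1 : ∀ y, ∑' a, T a (ψ y) * z a = (M *ᵥ v) y / t := by
    intro y
    rw [← hφ.tsum_eq, tsum_fintype, Matrix.mulVec, dotProduct, Finset.sum_div]
    · refine Finset.sum_congr rfl fun x _ => ?_
      rw [hzφ, mul_div_assoc]; rfl
    · intro a ha
      by_contra har
      exact ha (by simp [hz0 a har])
  have h2 : ENNReal.ofReal (∑ y, ‖(M *ᵥ v) y / t‖ ^ 2) ≤ ∑' b, ‖∑' a, T a b * z a‖ₑ ^ 2 := by
    rw [ENNReal.ofReal_sum_of_nonneg fun _ _ => by positivity]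
    calc _ = ∑ b ∈ Finset.univ.map ⟨ψ, hψ⟩, ‖∑' a, T a b * z a‖ₑ ^ 2 := by
          rw [Finset.sum_map]
          refine Finset.sum_congr rfl fun y _ => ?_
          rw [Function.Embedding.coeFn_mk, h1, enorm_sq_eq_ofReal]
      _ ≤ _ := ENNReal.sum_le_tsum _
  have h3 : ENNReal.ofReal (Real.sqrt (∑ y, ‖(M *ᵥ v) y / t‖ ^ 2)) ≤ kernelNorm T := by
    refine le_trans ?_ (le_iSup₂_of_le z hz le_rfl)
    rw [← ofReal_sq_rpow_half (Real.sqrt_nonneg _),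
      Real.sq_sqrt (Finset.sum_nonneg fun _ _ => by positivity)]
    gcongr
  have h4 := (ENNReal.ofReal_le_iff_le_toReal htop).mp h3
  have h5 := (Real.sqrt_le_left ENNReal.toReal_nonneg).mp h4
  simp only [norm_div, div_pow, Complex.norm_real, Real.norm_of_nonneg ht.le] at h5
  rw [← Finset.sum_div, hts, div_le_iff₀ hpos] at h5
  exact h5

end Kernel

/-! ### Restriction to a finite box -/

section Box

/-- The lattice points with coordinates of size at most `N`. -/
noncomputable def box (d N : ℕ) : Finset (Lattice d) :=
  Fintype.piFinset fun _ => Finset.Icc (-(N : ℤ)) N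

theorem card_box (d N : ℕ) : (box d N).card = (2 * N + 1) ^ d := by
  rw [box, Fintype.card_piFinset_const, Int.card_Icc]
  congr 1
  omega

theorem mem_box_of_abs_le {d : ℕ} {x : ℝ} {k : Lattice d} (h : ∀ i, |(k i : ℝ)| ≤ x) :
    k ∈ box d ⌊x⌋₊ := by
  rw [box, Fintype.mem_piFinset]
  intro i
  rw [Finset.mem_Icc, ← abs_le]
  have h1 : ((k i).natAbs : ℝ) ≤ x := by
    rw [Nat.cast_natAbs, Int.cast_abs]; exact h i
  have h2 := Nat.le_floor h1
  rw [Int.abs_eq_natAbs]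
  exact_mod_cast h2

theorem mem_box_of_bracket_le {d : ℕ} {x : ℝ} {k : Lattice d} (h : bracket k ≤ x) :
    k ∈ box d ⌊x⌋₊ := by
  refine mem_box_of_abs_le fun i => le_trans (Real.abs_le_sqrt ?_) h
  have := Finset.single_le_sum (f := fun i => (k i : ℝ) ^ 2) (fun _ _ => by positivity)
    (Finset.mem_univ i)
  linarith

theorem mem_box_of_bracketPow_le {d n : ℕ} {x : ℝ} {b : Fin n → Lattice d} (h : bracketPow b ≤ x)
    (l : Fin n) : b l ∈ box d ⌊x⌋₊ := by
  refine mem_box_of_abs_le fun i => le_trans (Real.abs_le_sqrt ?_) h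
  have h1 := Finset.single_le_sum (f := fun i => (b l i : ℝ) ^ 2) (fun _ _ => by positivity)
    (Finset.mem_univ i)
  have h2 := Finset.single_le_sum (f := fun l => ∑ i, (b l i : ℝ) ^ 2) (fun _ _ => by positivity)
    (Finset.mem_univ l)
  exact h1.trans (h2.trans (le_add_of_nonneg_left zero_le_one))

variable {d m n : ℕ} {A : Type*} [Fintype A] [DecidableEq A]

/-- The entries of the tensor `h` with all vectors in `Q` and all `k_j` in `E`. -/
def truncate (Q E : Finset (Lattice d))
    (h : (Fin m → Lattice d) → (Fin n → Lattice d) → (A → Lattice d) → ℂ) :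
    (A → {k // k ∈ E}) → (Fin n → {k // k ∈ Q}) → (Fin m → {k // k ∈ Q}) → ℂ :=
  fun k c b => h (fun l => (b l).1) (fun l => (c l).1) fun j => (k j).1

/-- Rows are outputs: the slots with value `true` go with c and those with `false` with b, so the
input set of the partition is the preimage of `false`. -/
theorem ofReal_opNorm_flatten_truncate_le (Q E : Finset (Lattice d))
    (h : (Fin m → Lattice d) → (Fin n → Lattice d) → (A → Lattice d) → ℂ) (B : A → Bool) :
    ENNReal.ofReal ‖flatten (toMatrices (truncate Q E h)) B‖
      ≤ tensorNorm h (Finset.univ.filter fun j => B j = false) := by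
  set S : Finset A := Finset.univ.filter fun j => B j = false
  have hS : ∀ {j}, j ∈ S ↔ B j = false := by simp [S]
  let φ : (Fin m → {k // k ∈ Q}) × ({j // B j = false} → {k // k ∈ E})
      → (Fin m → Lattice d) × ({j // j ∈ S} → Lattice d) :=
    fun x => (fun l => (x.1 l).1, fun j => (x.2 ⟨j.1, hS.mp j.2⟩).1)
  let ψ : (Fin n → {k // k ∈ Q}) × ({j // B j = true} → {k // k ∈ E})
      → (Fin n → Lattice d) × ({j // j ∉ S} → Lattice d) :=
    fun x => (fun l => (x.1 l).1, fun j => (x.2 ⟨j.1, by simpa [hS] using j.2⟩).1)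
  have hφ : φ.Injective := fun x x' hx => by
    refine Prod.ext (funext fun l => Subtype.ext ?_) (funext fun j => Subtype.ext ?_)
    · exact congrFun (congrArg Prod.fst hx) l
    · exact congrFun (congrArg Prod.snd hx) ⟨j.1, hS.mpr j.2⟩
  have hψ : ψ.Injective := fun x x' hx => by
    refine Prod.ext (funext fun l => Subtype.ext ?_) (funext fun j => Subtype.ext ?_)
    · exact congrFun (congrArg Prod.fst hx) l
    · exact congrFun (congrArg Prod.snd hx) ⟨j.1, by simp [hS, j.2]⟩
  refine le_trans (le_of_eq ?_) (opNorm_le_kernelNorm _ hφ hψ)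
  congr 2
  ext y x
  simp only [flatten, toMatrices, truncate, Matrix.of_apply, φ, ψ]
  congr 1
  funext j
  by_cases hj : B j = true
  · simp [join, glue, hS, hj]
  · simp [join, glue, hS, hj]

theorem ofReal_maxFlattenNorm_truncate_le (Q E : Finset (Lattice d))
    (h : (Fin m → Lattice d) → (Fin n → Lattice d) → (A → Lattice d) → ℂ) :
    ENNReal.ofReal (maxFlattenNorm (toMatrices (truncate Q E h)))
      ≤ ⨆ B : Finset A, tensorNorm h B := by
  obtain ⟨B, hB⟩ := exists_maxFlattenNorm_eq (toMatrices (truncate Q E h))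
  rw [hB]
  exact (ofReal_opNorm_flatten_truncate_le Q E h B).trans (le_iSup (tensorNorm h) _)

/-- The support condition makes the summands with some k_j outside Q vanish, so E may be replaced by
E ∩ Q. -/
theorem kernelNorm_contraction_le (Q E : Finset (Lattice d)) (ζ : A → ℤˣ) (u : Lattice d → ℂ)
    {h : (Fin m → Lattice d) → (Fin n → Lattice d) → (A → Lattice d) → ℂ}
    (hQ : ∀ b c k, h b c k ≠ 0 → (∀ l, b l ∈ Q) ∧ (∀ l, c l ∈ Q) ∧ ∀ j, k j ∈ Q) :
    kernelNorm (contraction ζ E u h)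
      ≤ ENNReal.ofReal ‖signPoly ζ (toMatrices (truncate Q (E ∩ Q) h)) fun k => u k.1‖ := by
  let φ : (Fin m → {k // k ∈ Q}) → Fin m → Lattice d := fun b l => (b l).1
  let ψ : (Fin n → {k // k ∈ Q}) → Fin n → Lattice d := fun c l => (c l).1
  have hφ : φ.Injective := fun x x' hx => funext fun l => Subtype.ext (congrFun hx l)
  have hψ : ψ.Injective := fun x x' hx => funext fun l => Subtype.ext (congrFun hx l)
  refine (kernelNorm_le_opNorm hφ hψ fun b c hbc => ?_).trans (le_of_eq ?_)
  · obtain ⟨k, -, hk⟩ := Finset.exists_ne_zero_of_sum_ne_zero hbc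
    have hk' := hQ b c k (left_ne_zero_of_mul hk)
    exact ⟨⟨fun l => ⟨b l, hk'.1 l⟩, rfl⟩, ⟨fun l => ⟨c l, hk'.2.1 l⟩, rfl⟩⟩
  · congr 2
    ext c b
    simp only [Matrix.of_apply, signPoly, Matrix.sum_apply, Matrix.smul_apply, toMatrices, truncate,
      smul_eq_mul, contraction, φ, ψ]
    symm
    refine Finset.sum_of_injOn (fun k j => (k j).1) ?_ ?_ ?_ ?_
    · intro k _ k' _ hkk
      exact funext fun j => Subtype.ext (congrFun hkk j)
    · intro k _
      simp only [Finset.mem_coe, Fintype.mem_piFinset]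
      exact fun j => (Finset.mem_inter.mp (k j).2).1
    · intro k hk hk'
      by_contra hne
      have h1 := (hQ _ _ k (left_ne_zero_of_mul hne)).2.2
      refine hk' ⟨fun j => ⟨k j, Finset.mem_inter.mpr ⟨Fintype.mem_piFinset.mp hk j, h1 j⟩⟩,
        by simp, rfl⟩
    · intro k _
      rw [mul_comm]

end Box

/-! ### The choice of the moment -/

/-- With x = L^θ' and p = ⌈x⌉ ≤ 2x, the chaos constant is at most (8x)^{pr}, and x^r ≤ L^θ because
θ' = θ/(r + 1). -/
theorem exists_moment_bound (r a : ℕ) {θ W D₀ : ℝ} (hθ : 0 < θ) (hW : 0 ≤ W) (hD₀ : 0 ≤ D₀) :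
    ∃ θ' : ℝ, 0 < θ' ∧ ∃ C : ℝ, 0 < C ∧ ∀ L D : ℝ, 1 ≤ L → 0 ≤ D → D ≤ D₀ * L ^ a →
      ∃ p : ℕ, p ≠ 0 ∧ W ^ (2 * p) * (2 * D * (4 * p) ^ p) ^ r / (C * L ^ θ) ^ (2 * p)
        ≤ C * Real.exp (-L ^ θ') := by
  set θ' : ℝ := θ / (r + 1)
  have hθ' : 0 < θ' := by positivity
  set t : ℕ := ⌈1 / θ'⌉₊
  -- Since L ≤ x^t, the dimension factor L^{ar} is at most x^N ≤ N! exp x.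
  set N : ℕ := t * (a * r)
  set V : ℝ := W ^ 2 * 8 ^ r * Real.exp 2
  set C : ℝ := V + 1 + (2 * D₀) ^ r * N.factorial
  have hV : 0 ≤ V := by positivity
  have hC0 : 0 ≤ (2 * D₀) ^ r * N.factorial := by positivity
  have hC1 : 1 ≤ C := by simp only [C]; linarith
  have hC : 0 < C := by linarith
  refine ⟨θ', hθ', C, hC, fun L D hL hD hDL => ?_⟩
  have hL0 : 0 < L := by linarith
  set x : ℝ := L ^ θ' with hx
  have hx1 : 1 ≤ x := Real.one_le_rpow hL hθ'.le
  have hx0 : 0 < x := by linarith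
  have hxr : x ^ (r + 1) = L ^ θ := by
    rw [hx, ← Real.rpow_natCast, ← Real.rpow_mul hL0.le]
    congr 1
    simp only [θ']
    push_cast
    field_simp
  have hLt : L ≤ x ^ t := by
    have h1 : x ^ (1 / θ') = L := by
      rw [hx, ← Real.rpow_mul hL0.le, mul_one_div_cancel hθ'.ne', Real.rpow_one]
    calc L = x ^ (1 / θ') := h1.symm
      _ ≤ x ^ (t : ℝ) := Real.rpow_le_rpow_of_exponent_le hx1 (Nat.le_ceil _)
      _ = x ^ t := Real.rpow_natCast _ _
  set p : ℕ := ⌈x⌉₊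
  have hp1 : x ≤ p := Nat.le_ceil x
  have hp2 : (p : ℝ) ≤ 2 * x := by linarith [Nat.ceil_lt_add_one hx0.le]
  have hp0 : p ≠ 0 := (Nat.ceil_pos.mpr hx0).ne'
  refine ⟨p, hp0, ?_⟩
  set Λ : ℝ := L ^ θ
  have hΛ : 1 ≤ Λ := Real.one_le_rpow hL hθ.le
  have hxΛ : x ^ r ≤ Λ := by
    rw [← hxr]; exact pow_le_pow_right₀ hx1 (Nat.le_succ r)
  have h4p : 4 * (p : ℝ) ≤ 8 * x := by linarith
  have hLN : (L ^ a) ^ r ≤ N.factorial * Real.exp x := by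
    have h1 := Real.pow_div_factorial_le_exp x hx0.le N
    rw [div_le_iff₀ (by positivity), mul_comm] at h1
    refine le_trans ?_ h1
    rw [← pow_mul, show N = t * (a * r) from rfl, pow_mul x]
    gcongr
  have hnum : W ^ (2 * p) * (2 * D * (4 * p) ^ p) ^ r
      ≤ (W ^ 2 * 8 ^ r * Λ) ^ p * ((2 * D₀) ^ r * (N.factorial * Real.exp x)) := by
    calc _ ≤ W ^ (2 * p) * (2 * (D₀ * L ^ a) * (8 * x) ^ p) ^ r := by gcongr
      _ = (W ^ 2 * 8 ^ r * x ^ r) ^ p * ((2 * D₀) ^ r * (L ^ a) ^ r) := by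
          simp only [mul_pow, ← pow_mul]
          rw [mul_comm p r]
          ring
      _ ≤ _ := by gcongr
  have hden : (V * Λ) ^ p ≤ (C * Λ) ^ (2 * p) := by
    rw [pow_mul]
    refine pow_le_pow_left₀ (by positivity) ?_ p
    have h1 : V ≤ C := by simp only [C]; linarith
    calc V * Λ ≤ C * Λ := by gcongr
      _ ≤ (C * Λ) * (C * Λ) := le_mul_of_one_le_right (by positivity) (one_le_mul_of_one_le_of_one_le hC1 hΛ)
      _ = _ := (sq _).symm
  -- The factor exp 2 in V supplies two copies of exp x: one pays for the dimensions, the other is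
  -- the tail.
  have hexp : Real.exp x * Real.exp x ≤ Real.exp 2 ^ p := by
    rw [← Real.exp_add, ← Real.exp_nat_mul]
    exact Real.exp_le_exp.mpr (by linarith)
  have hcancel : Real.exp x * Real.exp (-x) = 1 := by rw [← Real.exp_add]; simp
  rw [div_le_iff₀ (by positivity)]
  calc _ ≤ (W ^ 2 * 8 ^ r * Λ) ^ p * ((2 * D₀) ^ r * (N.factorial * Real.exp x)) := hnum
    _ = ((2 * D₀) ^ r * N.factorial) * Real.exp (-x)
        * ((W ^ 2 * 8 ^ r * Λ) ^ p * (Real.exp x * Real.exp x)) := by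
        linear_combination (-(W ^ 2 * 8 ^ r * Λ) ^ p * ((2 * D₀) ^ r * (N.factorial * Real.exp x)))
          * hcancel
    _ ≤ C * Real.exp (-x) * ((W ^ 2 * 8 ^ r * Λ) ^ p * Real.exp 2 ^ p) := by
        gcongr
        simp only [C]; linarith
    _ = C * Real.exp (-x) * (V * Λ) ^ p := by
        simp only [V, mul_pow]; ring
    _ ≤ _ := by gcongr

/-- The dimensions are polynomial in L uniformly in E, since only E ∩ Q enters; |K| allows for
negative K. -/
theorem card_truncation_le {d m n r : ℕ} {K L M : ℝ} (hM : 1 ≤ M) (hML : M ≤ L)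
    (Q E : Finset (Lattice d)) (hQ : Q.card = (2 * ⌊K * M⌋₊ + 1) ^ d) :
    ((Fintype.card (Fin n → {k // k ∈ Q}) + Fintype.card (Fin m → {k // k ∈ Q}) : ℝ)
      * (Fintype.card {k // k ∈ E ∩ Q} + 1) ^ r
      ≤ (2 * 2 ^ r * (2 * |K| + 1) ^ (d * (m + n + r))) * L ^ (d * (m + n + r))) := by
  set q : ℝ := ((2 * |K| + 1) * L) ^ d
  have hL : 1 ≤ L := hM.trans hML
  have hbase : 1 ≤ (2 * |K| + 1) * L :=
    one_le_mul_of_one_le_of_one_le (by linarith [abs_nonneg K]) hL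
  have hq1 : 1 ≤ q := one_le_pow₀ hbase
  have hQq : (Q.card : ℝ) ≤ q := by
    rw [hQ]
    push_cast
    refine pow_le_pow_left₀ (by positivity) ?_ d
    have h1 : (⌊K * M⌋₊ : ℝ) ≤ |K| * L := by
      refine (Nat.cast_le.mpr (Nat.floor_le_floor (a := K * M) (b := |K| * L) ?_)).trans
        (Nat.floor_le (by positivity))
      calc K * M ≤ |K| * M := by gcongr; exact le_abs_self K
        _ ≤ |K| * L := by gcongr
    nlinarith
  have hEq : (Fintype.card {k // k ∈ E ∩ Q} : ℝ) ≤ q := by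
    rw [Fintype.card_coe]
    exact le_trans (by exact_mod_cast Finset.card_le_card Finset.inter_subset_right) hQq
  rw [Fintype.card_fun, Fintype.card_fun, Fintype.card_coe, Fintype.card_fin, Fintype.card_fin]
  push_cast
  calc _ ≤ (q ^ (m + n) + q ^ (m + n)) * (q + q) ^ r := by
        gcongr ?_ * (?_ + ?_) ^ r
        gcongr ?_ + ?_
        · refine (pow_le_pow_left₀ (by positivity) hQq n).trans (pow_le_pow_right₀ hq1 (by omega))
        · refine (pow_le_pow_left₀ (by positivity) hQq m).trans (pow_le_pow_right₀ hq1 (by omega))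
    _ = 2 * 2 ^ r * q ^ (m + n + r) := by rw [← two_mul, ← two_mul, mul_pow, pow_add q (m + n)]; ring
    _ = _ := by simp only [q]; rw [← pow_mul, mul_pow]; ring

end RandomTensor

/-! ### Assembly: truncation, tail bound and comparison of norms. -/

theorem proposition2p6 (d m n r : ℕ) (K θ : ℝ) (hθ : 0 < θ) :
    ∃ θ' : ℝ, 0 < θ' ∧ ∃ C : ℝ, 0 < C ∧
      ∀ (A : Type*) [Fintype A] [DecidableEq A] (ζ : A → ℤˣ), Fintype.card A = r →
      ∀ (Ω : Type*) [MeasurableSpace Ω] (P : Measure Ω) [IsProbabilityMeasure P]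
        (η : RandomTensor.Lattice d → Ω → ℂ),
        (∀ k, Measurable (η k)) →
        (∀ k, P.map (η k) = RandomTensor.unitCircleLaw) →
        iIndepFun η P →
      ∀ (M τ : ℝ), (∃ s : ℕ, M = 2 ^ s) → 0 < τ → τ ≤ 1 →
      ∀ (h : Ω → (Fin m → RandomTensor.Lattice d) → (Fin n → RandomTensor.Lattice d) →
          (A → RandomTensor.Lattice d) → ℂ)
        (E : Finset (RandomTensor.Lattice d)),
        (∀ b c k, Measurable (fun ω => h ω b c k)) →
        (∀ ω b c k, h ω b c k ≠ 0 →
          RandomTensor.bracketPow b ≤ K * M ∧ RandomTensor.bracketPow c ≤ K * M ∧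
          (∀ j, RandomTensor.bracket (k j) ≤ K * M) ∧
          (∀ i j, ¬ RandomTensor.IsPairing ζ k i j)) →
        IndepFun (fun ω (x : (Fin m → RandomTensor.Lattice d) × (Fin n → RandomTensor.Lattice d) ×
            (A → RandomTensor.Lattice d)) => h ω x.1 x.2.1 x.2.2)
          (fun ω (k : {k // k ∈ E}) => η k ω) P →
        P {ω | ¬ (RandomTensor.kernelNorm
              (RandomTensor.contraction ζ E (fun k => η k ω) (h ω))
            ≤ ENNReal.ofReal (C * τ ^ (-θ) * M ^ θ) *
              ⨆ B : Finset A, RandomTensor.tensorNorm (h ω) B)}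
          ≤ ENNReal.ofReal (C * Real.exp (-(τ⁻¹ * M) ^ θ')) := by
  -- W is the total decoupling weight; D₀ and the exponent d(m + n + r) come from counting points of
  -- the box.
  obtain ⟨θ', hθ', C, hC, hbound⟩ := RandomTensor.exists_moment_bound r (d * (m + n + r))
    (W := (r : ℝ) ^ r * ((r : ℝ) + 1) ^ r)
    (D₀ := 2 * 2 ^ r * (2 * |K| + 1) ^ (d * (m + n + r))) hθ (by positivity) (by positivity)
  refine ⟨θ', hθ', C, hC, ?_⟩
  rintro A _ _ ζ rfl Ω _ P _ η hm hlaw hind M τ ⟨s, hs⟩ hτ hτ1 h E hh hsupp hindep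
  have hM : 1 ≤ M := by rw [hs]; exact one_le_pow₀ (by norm_num)
  have hM0 : 0 ≤ M := by linarith
  set L : ℝ := τ⁻¹ * M
  have hML : M ≤ L := le_mul_of_one_le_left hM0 ((one_le_inv₀ hτ).mpr hτ1)
  have hL : 1 ≤ L := hM.trans hML
  have hscale : C * τ ^ (-θ) * M ^ θ = C * L ^ θ := by
    rw [Real.mul_rpow (by positivity) hM0, Real.inv_rpow hτ.le, Real.rpow_neg hτ.le, mul_assoc]
  set Q := RandomTensor.box d ⌊K * M⌋₊
  have hcard := RandomTensor.card_truncation_le (m := m) (n := n) (r := Fintype.card A) hM hML Q E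
    (RandomTensor.card_box d _)
  obtain ⟨p, hp, hpb⟩ := hbound L _ hL (by positivity) hcard
  have hl : 0 < C * L ^ θ := by positivity
  set X : Ω → (A → {k // k ∈ E ∩ Q}) → (Fin n → {k // k ∈ Q}) → (Fin m → {k // k ∈ Q}) → ℂ :=
    fun ω => RandomTensor.truncate Q (E ∩ Q) (h ω) with hXdef
  have hX : Measurable X := measurable_pi_lambda _ fun k => measurable_pi_lambda _ fun c =>
    measurable_pi_lambda _ fun b => hh _ _ _
  let φ (y : (Fin m → RandomTensor.Lattice d) × (Fin n → RandomTensor.Lattice d) ×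
      (A → RandomTensor.Lattice d) → ℂ) (k : A → {k // k ∈ E ∩ Q}) (c : Fin n → {k // k ∈ Q})
      (b : Fin m → {k // k ∈ Q}) : ℂ := y (fun l => (b l).1, fun l => (c l).1, fun j => (k j).1)
  let ψ (y : {k // k ∈ E} → ℂ) (k : {k // k ∈ E ∩ Q}) : ℂ :=
    y ⟨k.1, (Finset.mem_inter.mp k.2).1⟩
  have hXη : IndepFun X (fun ω (k : {k // k ∈ E ∩ Q}) => η k ω) P :=
    hindep.comp (φ := φ) (ψ := ψ)
      (measurable_pi_lambda _ fun k => measurable_pi_lambda _ fun c =>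
        measurable_pi_lambda _ fun b => measurable_pi_apply _)
      (measurable_pi_lambda _ fun k => measurable_pi_apply _)
  -- Two signs that differ are opposite, so equal vectors with different signs would form a pairing.
  have hζ : ∀ ω k, RandomTensor.toMatrices (X ω) k ≠ 0 → ∀ i j, k i = k j → ζ i = ζ j := by
    intro ω k hk i j hij
    obtain ⟨c, b, hcb⟩ : ∃ c b, X ω k c b ≠ 0 := by
      by_contra! hall
      exact hk (by ext c b; exact hall c b)
    have hnp := (hsupp ω _ _ _ hcb).2.2.2 i j
    by_contra hne
    refine hnp ⟨?_, congrArg Subtype.val hij⟩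
    rw [Int.units_ne_iff_eq_neg.mp hne]
    simp
  refine (measure_mono fun ω hω => ?_).trans
    ((RandomTensor.measure_lt_opNorm_signPoly_le hX (fun k => hm k.1) (fun k => hlaw k.1)
      (hind.precomp (g := fun k : {k // k ∈ E ∩ Q} => k.1) Subtype.val_injective) hXη hζ hp
      le_rfl le_rfl hl).trans (ENNReal.ofReal_le_ofReal hpb))
  rw [Set.mem_ofPred_eq] at hω ⊢
  by_contra hle
  rw [not_lt] at hle
  refine hω ?_
  refine (RandomTensor.kernelNorm_contraction_le Q E ζ _ fun b c k hne => ?_).trans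
    ((ENNReal.ofReal_le_ofReal hle).trans ?_)
  · obtain ⟨hb, hc, hk, -⟩ := hsupp ω b c k hne
    exact ⟨RandomTensor.mem_box_of_bracketPow_le hb, RandomTensor.mem_box_of_bracketPow_le hc,
      fun j => RandomTensor.mem_box_of_bracket_le (hk j)⟩
  · rw [hscale, ENNReal.ofReal_mul hl.le]
    gcongr
    exact RandomTensor.ofReal_maxFlattenNorm_truncate_le Q (E ∩ Q) (h ω)
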